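/- Let $n\ge 2$ and let $P=\mathbb{R}\times\mathbb{R}^{n-1}$ with points $(\tau,y)$, $y=r\vartheta$, $r=|y|$, $\vartheta\in\mathbb{S}^{n-2}$, be endowed with a smooth Riemannian metric of the form $$g_0=\xi^2(r)\,d\tau^2+dr^2+\chi^2(r)\,d\vartheta^2,$$ where $\xi,\chi:\mathbb{R}\to\mathbb{R}$ are smooth and satisfy the regularity conditions $\xi(0)=1$, $\xi^{(2k+1)}(0)=0$ and $\chi^{(2k)}(0)=0$ for all $k\ge 0$, $\chi'(0)=1$, and $\xi,\chi>0$ on $(0,\infty)$; the displayed form is required for all $r\in\mathbb{R}$, so that $(r,\vartheta)$ and $(-r,-\vartheta)$ represent the same point. (Such a metric is automatically complete. For $n=2$ one has $\mathbb{S}^0=\{\pm1\}$, there is no $\vartheta$-direction, and $\xi$ is even.) Suppose that all sectional curvatures of $g_0$ are negative. Let $h=\frac{1}{n-1}\Delta r$ be the mean curvature of the equidistants $E_\rho=\{r=\rho\}$ of the geodesic $\{r=0\}$, and suppose that $h>0$ for $r>0$ and that $\lim_{r\to+\infty}h(r)$ exists and is finite. Then for every $c\in\mathbb{R}$ there is a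 smooth function $u:P\to\mathbb{R}$ whose entire graph $M=\{(u(x),x):x\in P\}$ is a translating soliton in the Riemannian product $(\mathbb{R}\times P,\,dt^2+g_0)$ with velocity $c$, that is, $c\,(\partial_t)^\perp=\mathbf{H}$ along $M$, where $\mathbf{H}$ is the (non-normalized) mean curvature vector, and $M$ is foliated by equidistants in the slices $P_t=\{t\}\times P$, that is, $M$ is a union of sets of the form $\{t\}\times E_\rho$. Moreover $u=f(r)$ for a smooth function $f:\mathbb{R}\to\mathbb{R}$ which satisfies, for every $r>0$, $$f''=(1+f'^2)\bigl(c-(n-1)\,h(r)\,f'\bigr).$$ -/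

import Mathlib

open scoped ContDiff

noncomputable section

namespace GrimReaper

/-! ## Riemannian geometry in one global chart

The manifolds below are diffeomorphic to a finite dimensional real vector space, which serves as a
global chart. A Riemannian metric is a field `g` of bilinear forms on `V`, with `g p v w` the inner
product at `p` of the tangent vectors `v`, `w`; components are taken with respect to a fixed basis
of `V`, and none of the notions depends on the choice of that basis. -/

section Metric

variable {V : Type*} [NormedAddCommGroup V] [NormedSpace ℝ V] [FiniteDimensional ℝ V]

/-- A smooth Riemannian metric on `V`. -/
structure IsRiemannianMetric (g : V → LinearMap.BilinForm ℝ V) : Prop where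
  symm : ∀ p v w, g p v w = g p w v
  pos : ∀ p v, v ≠ 0 → 0 < g p v v
  smooth : ∀ v w, ContDiff ℝ ∞ fun p => g p v w

/-- The inverse matrix `B^{ij}` of the matrix `B_{ij}` of a bilinear form. -/
def inverseGram (B : LinearMap.BilinForm ℝ V) :
    Matrix (Fin (Module.finrank ℝ V)) (Fin (Module.finrank ℝ V)) ℝ :=
  (Matrix.of fun i j => B (Module.finBasis ℝ V i) (Module.finBasis ℝ V j))⁻¹

/-- The trace `B^{ij} T(b_i, b_j)` of `T` with respect to the inner product `B`; it equals
`∑ T(e_i, e_i)` for every `B`-orthonormal basis `e` if `T` is bilinear. -/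
def metricTrace {W : Type*} [AddCommGroup W] [Module ℝ W]
    (B : LinearMap.BilinForm ℝ V) (T : V → V → W) : W :=
  ∑ i, ∑ j, inverseGram B i j • T (Module.finBasis ℝ V i) (Module.finBasis ℝ V j)

/-- The Christoffel symbols of the Levi-Civita connection,
`Γ(v, w) = g^{ij} · ½ (∂_v g(w, b_i) + ∂_w g(v, b_i) - ∂_{b_i} g(v, w)) b_j`: for vector fields
`Y`, `Z` one has `∇_Y Z = D_Y Z + Γ(Y, Z)`. -/
def christoffel (g : V → LinearMap.BilinForm ℝ V) (p v w : V) : V :=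
  metricTrace (g p) fun a b =>
    ((1 / 2 : ℝ) * (fderiv ℝ (fun q => g q w a) p v + fderiv ℝ (fun q => g q v a) p w
      - fderiv ℝ (fun q => g q v w) p a)) • b

/-- The curvature tensor `R(v, w) z = ∇_v ∇_w z - ∇_w ∇_v z` for constant vector fields. -/
def curvatureTensor (g : V → LinearMap.BilinForm ℝ V) (p v w z : V) : V :=
  fderiv ℝ (fun q => christoffel g q w z) p v - fderiv ℝ (fun q => christoffel g q v z) p w
    + christoffel g p v (christoffel g p w z) - christoffel g p w (christoffel g p v z)

/-- The sectional curvature at `p` of the plane spanned by `v` and `w`. -/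
def sectionalCurvature (g : V → LinearMap.BilinForm ℝ V) (p v w : V) : ℝ :=
  g p (curvatureTensor g p v w w) v / (g p v v * g p w w - g p v w ^ 2)

/-- The Hessian `∇² f (v, w) = D² f (v, w) - D f (Γ(v, w))` of a function. -/
def hessian (g : V → LinearMap.BilinForm ℝ V) (f : V → ℝ) (p v w : V) : ℝ :=
  fderiv ℝ (fun q => fderiv ℝ f q w) p v - fderiv ℝ f p (christoffel g p v w)

/-- The Laplace-Beltrami operator. -/
def laplaceBeltrami (g : V → LinearMap.BilinForm ℝ V) (f : V → ℝ) (p : V) : ℝ :=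
  metricTrace (g p) (hessian g f p)

end Metric

/-! ## Immersed submanifolds and their mean curvature -/

section Immersion

variable {U V : Type*} [NormedAddCommGroup U] [NormedSpace ℝ U] [FiniteDimensional ℝ U]
  [NormedAddCommGroup V] [NormedSpace ℝ V] [FiniteDimensional ℝ V]

/-- The metric induced on `U` by `ψ : U → V`. -/
def inducedMetric (g : V → LinearMap.BilinForm ℝ V) (ψ : U → V) (x : U) :
    LinearMap.BilinForm ℝ U :=
  (g (ψ x)).compl₁₂ (fderiv ℝ ψ x : U →ₗ[ℝ] V) (fderiv ℝ ψ x : U →ₗ[ℝ] V)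

/-- The orthogonal projection of `z ∈ T_{ψ x} V` to the tangent space of the immersion. -/
def tangentialPart (g : V → LinearMap.BilinForm ℝ V) (ψ : U → V) (x : U) (z : V) : V :=
  metricTrace (inducedMetric g ψ x) fun a b => g (ψ x) z (fderiv ℝ ψ x a) • fderiv ℝ ψ x b

/-- The orthogonal projection of `z ∈ T_{ψ x} V` to the normal space of the immersion. -/
def normalPart (g : V → LinearMap.BilinForm ℝ V) (ψ : U → V) (x : U) (z : V) : V :=
  z - tangentialPart g ψ x z

/-- The second fundamental form, the normal part of the ambient covariant derivative of `ψ_* b`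
in the direction of `ψ_* a`. -/
def secondFundamentalForm (g : V → LinearMap.BilinForm ℝ V) (ψ : U → V) (x a b : U) : V :=
  normalPart g ψ x (fderiv ℝ (fun y => fderiv ℝ ψ y b) x a
    + christoffel g (ψ x) (fderiv ℝ ψ x a) (fderiv ℝ ψ x b))

/-- The (non-normalized) mean curvature vector. -/
def meanCurvatureVector (g : V → LinearMap.BilinForm ℝ V) (ψ : U → V) (x : U) : V :=
  metricTrace (inducedMetric g ψ x) (secondFundamentalForm g ψ x)

/-- The Riemannian product metric `dt² + g` on `ℝ × V`. -/
def productMetric (g : V → LinearMap.BilinForm ℝ V) (q : ℝ × V) :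
    LinearMap.BilinForm ℝ (ℝ × V) :=
  (LinearMap.mul ℝ ℝ).compl₁₂ (LinearMap.fst ℝ ℝ V) (LinearMap.fst ℝ ℝ V)
    + (g q.2).compl₁₂ (LinearMap.snd ℝ ℝ V) (LinearMap.snd ℝ ℝ V)

/-- A translating soliton in `ℝ × V` with velocity `c`: an immersion with `c X^⊥ = H`, where
`X = ∂_t`. -/
structure IsTranslatingSoliton (g : V → LinearMap.BilinForm ℝ V) (c : ℝ) (ψ : U → ℝ × V) :
    Prop where
  smooth : ContDiff ℝ ∞ ψ
  immersion : ∀ x, Function.Injective (fderiv ℝ ψ x)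
  soliton : ∀ x, c • normalPart (productMetric g) ψ x ((1 : ℝ), (0 : V))
    = meanCurvatureVector (productMetric g) ψ x

end Immersion

/-! ## The manifold `P` in cylindrical coordinates -/

/-- The manifold `P` of dimension `n`, with points `(τ, y)`, where `y = r ϑ` with `ϑ` in the unit
sphere of dimension `n - 2`. -/
abbrev P (n : ℕ) : Type := ℝ × EuclideanSpace ℝ (Fin (n - 1))

/-- The coordinate `r`. -/
def radius {n : ℕ} (x : P n) : ℝ := ‖x.2‖

/-- The regularity conditions on the coefficients of the metric. -/
structure RegularCoefficients (ξ χ : ℝ → ℝ) : Prop where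
  smooth_xi : ContDiff ℝ ∞ ξ
  xi_zero : ξ 0 = 1
  xi_odd : ∀ k : ℕ, iteratedDeriv (2 * k + 1) ξ 0 = 0
  xi_pos : ∀ r, 0 < r → 0 < ξ r
  smooth_chi : ContDiff ℝ ∞ χ
  chi_even : ∀ k : ℕ, iteratedDeriv (2 * k) χ 0 = 0
  chi_deriv : deriv χ 0 = 1
  chi_pos : ∀ r, 0 < r → 0 < χ r

/-- The metric `g` has the form `ξ(r)² dτ² + dr² + χ(r)² dϑ²`: at the point with coordinates
`(τ, r, ϑ)` the coordinate vectors are `∂_τ = (1, 0)`, `∂_r = (0, ϑ)`, and `(0, r η)` for a vector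
`η` tangent to the unit sphere at `ϑ`. -/
def HasCylindricalForm {n : ℕ} (g : P n → LinearMap.BilinForm ℝ (P n)) (ξ χ : ℝ → ℝ) : Prop :=
  ∀ (τ r : ℝ) (ϑ η η' : EuclideanSpace ℝ (Fin (n - 1))) (a b a' b' : ℝ),
    ‖ϑ‖ = 1 → inner ℝ ϑ η = 0 → inner ℝ ϑ η' = 0 →
    g (τ, r • ϑ) (a, b • ϑ + r • η) (a', b' • ϑ + r • η')
      = ξ r ^ 2 * (a * a') + b * b' + χ r ^ 2 * inner ℝ η η'

/-- The (normalized) mean curvature `h = Δ r / (n - 1)` of the level sets of `r`, at a point with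
`r > 0`. -/
def equidistantMeanCurvature {n : ℕ} (g : P n → LinearMap.BilinForm ℝ (P n)) (x : P n) : ℝ :=
  laplaceBeltrami g radius x / ((n : ℝ) - 1)

/-- The equidistant at distance `ρ` from the geodesic `r = 0`. -/
def equidistant (n : ℕ) (ρ : ℝ) : Set (P n) := {x | radius x = ρ}

/-- A subset of `ℝ × P` is foliated by equidistants in the slices `P_t = {t} × P` if it is a union
of sets of the form `{t} × E` with `E` an equidistant (these are pairwise disjoint). -/
def FoliatedByEquidistants {n : ℕ} (M : Set (ℝ × P n)) : Prop :=
  ∀ q ∈ M, {q.1} ×ˢ equidistant n (radius q.2) ⊆ M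

/-- The parametrization `x ↦ (u(x), x)` of the graph of `u`. -/
def graphMap {n : ℕ} (u : P n → ℝ) (x : P n) : ℝ × P n := (u x, x)

end GrimReaper

end

/-!
The normal part of the covariant derivative of `ψ_* b` along the graph `ψ x = (u x, x)` is the
Hessian of `u` times the normal part of `∂_t`, because what remains of it is `ψ_*` of a Christoffel
symbol (`secondFundamentalForm_graph`). So the graph is a translating soliton as soon as the trace
of the Hessian of `u` with respect to the induced metric `g + du²` is the constant `c`. Traces are
evaluated without frames, from the single identity `metricTrace_repr`.

For `u = f(r)` with `f' = r κ(r)`, the Gauss lemma and the derivative of the metric along rays give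
the Hessian, and the equation becomes `f'' / (1 + f'²) + H f' = c`, where
`H = ξ' / ξ + (n - 2) χ' / χ = Δ r` (`metricTrace_hessian_radial`, `laplaceBeltrami_radius`). On the
geodesic `r = 0` it reads `(n - 1) κ(0) = c` (`metricTrace_hessian_center`).

This ordinary differential equation is singular at `r = 0`. With `z = f' / √(1 + f'²)`, the sine of
the slope angle, it is `z' = c √(1 - z²) - H z`, that is,
`z = c J⁻¹ ∫₀ʳ J √(1 - z²)` with the area density `J = ξ χ^(n-2)`, which is nondecreasing as `H > 0`.
One may assume `c ≥ 0`. If the square root is truncated to a Lipschitz function, this is a Volterra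
equation with a global solution (`exists_fixedPoint_of_volterra`). On a bounded interval `z` stays
away from `1`, since `H` is bounded below away from `r = 0` and `z ≤ c r`; so the truncation is
immaterial there (`IsAreaDensity.exists_solvesAngle`), and uniqueness glues the solutions together.

For the smoothness at `r = 0`, put `J = r^k j` and `z = r ζ`. The integral equation expresses `ζ`
through weighted averages `A_k φ(r) = ∫₀¹ tᵏ φ(r t) dt`, the nonlinear part being
`r² A_{k+2} φ` with `φ` a smooth function of `r` and `ζ`. The operator `r² A_{k+2}` gains one
derivative (`contDiff_sq_mul_radialAverage`), so `ζ` is smooth on the whole line, and it is even.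
Hence `f` is smooth and even, and then `f(|y|)` is smooth (`contDiff_comp_norm`).
-/

noncomputable section

namespace GrimReaper

/-! ### Traces and the Christoffel symbols -/

section Trace

variable {V W W' : Type*} [NormedAddCommGroup V] [NormedSpace ℝ V] [FiniteDimensional ℝ V]
  [AddCommGroup W] [Module ℝ W] [AddCommGroup W'] [Module ℝ W']

omit [FiniteDimensional ℝ V] in
theorem nondegenerate_of_pos {B : LinearMap.BilinForm ℝ V} (hB : ∀ v, v ≠ 0 → 0 < B v v) :
    B.Nondegenerate := by
  constructor
  · intro v hv
    by_contra h
    exact (hB v h).ne' (hv v)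
  · intro v hv
    by_contra h
    exact (hB v h).ne' (hv v)

theorem isUnit_det_gram {B : LinearMap.BilinForm ℝ V} (hB : ∀ v, v ≠ 0 → 0 < B v v) :
    IsUnit (Matrix.of fun i j => B (Module.finBasis ℝ V i) (Module.finBasis ℝ V j)).det := by
  have h := (LinearMap.BilinForm.nondegenerate_iff_det_ne_zero (Module.finBasis ℝ V)).1
    (nondegenerate_of_pos hB)
  rw [isUnit_iff_ne_zero]
  convert h using 2
  ext i j
  simp [LinearMap.BilinForm.toMatrix_apply]

theorem metricTrace_map (B : LinearMap.BilinForm ℝ V) (T : V → V → W) (L : W →ₗ[ℝ] W') :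
    metricTrace B (fun a b => L (T a b)) = L (metricTrace B T) := by
  simp [metricTrace, map_sum]

theorem metricTrace_add (B : LinearMap.BilinForm ℝ V) (T T' : V → V → W) :
    metricTrace B (fun a b => T a b + T' a b) = metricTrace B T + metricTrace B T' := by
  simp [metricTrace, Finset.sum_add_distrib]

theorem metricTrace_smul (B : LinearMap.BilinForm ℝ V) (T : V → V → W) (c : ℝ) :
    metricTrace B (fun a b => c • T a b) = c • metricTrace B T := by
  simp only [metricTrace, Finset.smul_sum, smul_comm c]

theorem metricTrace_smul_const (B : LinearMap.BilinForm ℝ V) (T : V → V → ℝ) (z : W) :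
    metricTrace B (fun a b => T a b • z) = metricTrace B T • z :=
  metricTrace_map B T (LinearMap.id.smulRight z)

/-- The trace over two slots one of which is paired with `z` replaces the other one by `z`. All
other facts on traces follow from this one, so that orthonormal frames are never needed. -/
theorem metricTrace_repr {B : LinearMap.BilinForm ℝ V} (hB : ∀ v, v ≠ 0 → 0 < B v v) (z : V) :
    metricTrace B (fun a b => B z a • b) = z := by
  set e := Module.finBasis ℝ V
  set M : Matrix (Fin (Module.finrank ℝ V)) (Fin (Module.finrank ℝ V)) ℝ :=
    Matrix.of fun i j => B (e i) (e j) with hM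
  have hMM : M * M⁻¹ = 1 := Matrix.mul_nonsing_inv M (isUnit_det_gram hB)
  have key : ∀ k, metricTrace B (fun a b => B (e k) a • b) = e k := by
    intro k
    have h : ∀ j, ∑ i, M k i * M⁻¹ i j = (1 : Matrix _ _ ℝ) k j := fun j => by
      rw [← hMM, Matrix.mul_apply]
    calc metricTrace B (fun a b => B (e k) a • b)
        = ∑ i, ∑ j, (M k i * M⁻¹ i j) • e j := by
          refine Finset.sum_congr rfl fun i _ => Finset.sum_congr rfl fun j _ => ?_
          rw [smul_smul, mul_comm]; rfl
      _ = ∑ j, (∑ i, M k i * M⁻¹ i j) • e j := by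
          rw [Finset.sum_comm]; simp_rw [Finset.sum_smul]
      _ = e k := by simp [h, Matrix.one_apply]
  let L : V →ₗ[ℝ] V :=
    { toFun := fun z => metricTrace B fun a b => B z a • b
      map_add' := fun z z' => by
        simp only [map_add, LinearMap.add_apply, add_smul, metricTrace_add]
      map_smul' := fun c z => by
        simp only [map_smul, LinearMap.smul_apply, smul_assoc]
        exact metricTrace_smul B _ c }
  have hL : L = LinearMap.id := e.ext fun k => key k
  exact congrArg (fun L : V →ₗ[ℝ] V => L z) hL

theorem metricTrace_mul {B : LinearMap.BilinForm ℝ V} (hB : ∀ v, v ≠ 0 → 0 < B v v) (z : V)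
    (α : V →ₗ[ℝ] ℝ) : metricTrace B (fun a b => B z a * α b) = α z := by
  conv_rhs => rw [← metricTrace_repr hB z, ← metricTrace_map]
  simp

theorem metricTrace_self {B : LinearMap.BilinForm ℝ V} (hB : ∀ v, v ≠ 0 → 0 < B v v)
    (hs : ∀ v w, B v w = B w v) : metricTrace B (fun a b => B a b) = Module.finrank ℝ V := by
  set e := Module.finBasis ℝ V
  set M : Matrix (Fin (Module.finrank ℝ V)) (Fin (Module.finrank ℝ V)) ℝ :=
    Matrix.of fun i j => B (e i) (e j) with hM
  have hMM : M⁻¹ * M = 1 := Matrix.nonsing_inv_mul M (isUnit_det_gram hB)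
  calc metricTrace B (fun a b => B a b) = ∑ i, (M⁻¹ * M) i i := by
        refine Finset.sum_congr rfl fun i _ => ?_
        rw [Matrix.mul_apply]
        refine Finset.sum_congr rfl fun j _ => ?_
        exact congrArg (M⁻¹ i j * ·) (hs (e i) (e j))
    _ = _ := by simp [hMM]

/-- The Koszul formula for constant vector fields. -/
theorem metric_christoffel {g : V → LinearMap.BilinForm ℝ V} (hg : IsRiemannianMetric g)
    (p v w a : V) : g p (christoffel g p v w) a
      = (1 / 2 : ℝ) * (fderiv ℝ (fun q => g q w a) p v + fderiv ℝ (fun q => g q v a) p w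
        - fderiv ℝ (fun q => g q v w) p a) := by
  have hd : ∀ x y, DifferentiableAt ℝ (fun q => g q x y) p := fun x y =>
    ((hg.smooth x y).differentiable (by simp)).differentiableAt
  have hadd : ∀ x y y', fderiv ℝ (fun q => g q x (y + y')) p
      = fderiv ℝ (fun q => g q x y) p + fderiv ℝ (fun q => g q x y') p := fun x y y' => by
    rw [← fderiv_add (hd _ _) (hd _ _)]; congr 1; ext q; simp
  have hsmul : ∀ x (c : ℝ) y, fderiv ℝ (fun q => g q x (c • y)) p
      = c • fderiv ℝ (fun q => g q x y) p := fun x c y => by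
    rw [← fderiv_const_smul (hd _ _)]; congr 1; ext q; simp
  let ℓ : V →ₗ[ℝ] ℝ :=
    { toFun := fun a => (1 / 2 : ℝ) * (fderiv ℝ (fun q => g q w a) p v
        + fderiv ℝ (fun q => g q v a) p w - fderiv ℝ (fun q => g q v w) p a)
      map_add' := fun a b => by
        simp only [hadd]
        simp only [map_add, add_apply]; ring
      map_smul' := fun c a => by
        simp only [hsmul]
        simp only [map_smul, smul_apply, smul_eq_mul, RingHom.id_apply]
        ring }
  obtain ⟨z, hz⟩ : ∃ z, ∀ a, g p z a = ℓ a :=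
    ⟨(LinearMap.BilinForm.toDual (g p) (nondegenerate_of_pos (hg.pos p))).symm ℓ,
      fun a => LinearMap.BilinForm.apply_toDual_symm_apply _ _⟩
  have : christoffel g p v w = z := by
    rw [← metricTrace_repr (hg.pos p) z]
    simp only [hz]; rfl
  rw [this, hz]; rfl

theorem ext_of_metric {g : LinearMap.BilinForm ℝ V} (hg : ∀ v, v ≠ 0 → 0 < g v v) {x y : V}
    (h : ∀ a, g x a = g y a) : x = y := by
  rw [← metricTrace_repr hg x, ← metricTrace_repr hg y]
  simp only [h]

end Trace

/-! ### Graphs in a Riemannian product -/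

section Graph

variable {V : Type*} [NormedAddCommGroup V] [NormedSpace ℝ V] [FiniteDimensional ℝ V]
  {g : V → LinearMap.BilinForm ℝ V} {u : V → ℝ}

omit [FiniteDimensional ℝ V] in
theorem productMetric_apply (g : V → LinearMap.BilinForm ℝ V) (q v w : ℝ × V) :
    productMetric g q v w = v.1 * w.1 + g q.2 v.2 w.2 := by
  simp [productMetric]

omit [FiniteDimensional ℝ V] in
theorem isRiemannianMetric_productMetric (hg : IsRiemannianMetric g) :
    IsRiemannianMetric (productMetric g) where
  symm p v w := by simp only [productMetric_apply, hg.symm p.2 v.2 w.2, mul_comm]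
  pos p v hv := by
    rw [productMetric_apply]
    by_cases h : v.2 = 0
    · have h1 : v.1 ≠ 0 := fun h1 => hv (Prod.ext h1 h)
      simpa [h] using h1
    · have := hg.pos p.2 v.2 h
      nlinarith [mul_self_nonneg v.1]
  smooth v w := by
    simp only [productMetric_apply]
    exact contDiff_const.add ((hg.smooth v.2 w.2).comp contDiff_snd)

omit [FiniteDimensional ℝ V] in
theorem fderiv_productMetric (hg : IsRiemannianMetric g) (p v w a : ℝ × V) :
    fderiv ℝ (fun q => productMetric g q v w) p a
      = fderiv ℝ (fun q => g q v.2 w.2) p.2 a.2 := by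
  simp only [productMetric_apply]
  have hd : DifferentiableAt ℝ (fun q => g q v.2 w.2) p.2 :=
    ((hg.smooth _ _).differentiable (by simp)).differentiableAt
  have h := (hd.hasFDerivAt.comp p (hasFDerivAt_snd (𝕜 := ℝ))).const_add (v.1 * w.1)
  rw [show (fun q : ℝ × V => v.1 * w.1 + g q.2 v.2 w.2)
    = fun q => v.1 * w.1 + ((fun q => g q v.2 w.2) ∘ Prod.snd) q from rfl, h.fderiv]
  rfl

theorem christoffel_productMetric (hg : IsRiemannianMetric g) (p v w : ℝ × V) :
    christoffel (productMetric g) p v w = (0, christoffel g p.2 v.2 w.2) := by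
  have hG := isRiemannianMetric_productMetric hg
  refine ext_of_metric (hG.pos p) fun a => ?_
  rw [metric_christoffel hG, productMetric_apply]
  simp only [fderiv_productMetric hg, metric_christoffel hg]
  simp

omit [FiniteDimensional ℝ V] in
theorem fderiv_graph (hu : ContDiff ℝ ∞ u) (x a : V) :
    fderiv ℝ (fun y => (u y, y)) x a = (fderiv ℝ u x a, a) := by
  have hd : DifferentiableAt ℝ u x := (hu.differentiable (by simp)).differentiableAt
  have h := (hd.hasFDerivAt.prodMk (hasFDerivAt_id x)).fderiv
  exact congrArg (fun L : V →L[ℝ] ℝ × V => L a) h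

omit [FiniteDimensional ℝ V] in
theorem inducedMetric_graph (hu : ContDiff ℝ ∞ u) (x v w : V) :
    inducedMetric (productMetric g) (fun y => (u y, y)) x v w
      = fderiv ℝ u x v * fderiv ℝ u x w + g x v w := by
  simp only [inducedMetric, LinearMap.compl₁₂_apply, ContinuousLinearMap.coe_coe,
    fderiv_graph hu, productMetric_apply]

omit [FiniteDimensional ℝ V] in
theorem inducedMetric_graph_pos (hg : IsRiemannianMetric g) (hu : ContDiff ℝ ∞ u) (x v : V)
    (hv : v ≠ 0) : 0 < inducedMetric (productMetric g) (fun y => (u y, y)) x v v := by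
  rw [inducedMetric_graph hu]
  nlinarith [hg.pos x v hv, mul_self_nonneg (fderiv ℝ u x v)]

omit [FiniteDimensional ℝ V] in
theorem normalPart_add (G : V → LinearMap.BilinForm ℝ V) {U : Type*} [NormedAddCommGroup U]
    [NormedSpace ℝ U] [FiniteDimensional ℝ U] (ψ : U → V) (x : U) (y z : V) :
    normalPart G ψ x (y + z) = normalPart G ψ x y + normalPart G ψ x z := by
  simp only [normalPart, tangentialPart, map_add, LinearMap.add_apply, add_smul, metricTrace_add]
  abel

omit [FiniteDimensional ℝ V] in
theorem normalPart_smul (G : V → LinearMap.BilinForm ℝ V) {U : Type*} [NormedAddCommGroup U]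
    [NormedSpace ℝ U] [FiniteDimensional ℝ U] (ψ : U → V) (x : U) (c : ℝ) (z : V) :
    normalPart G ψ x (c • z) = c • normalPart G ψ x z := by
  simp only [normalPart, tangentialPart, map_smul, LinearMap.smul_apply, smul_sub, smul_assoc]
  rw [metricTrace_smul]

theorem normalPart_tangent (hg : IsRiemannianMetric g) (hu : ContDiff ℝ ∞ u) (x a : V) :
    normalPart (productMetric g) (fun y => (u y, y)) x (fderiv ℝ u x a, a) = 0 := by
  have h := metricTrace_repr (inducedMetric_graph_pos hg hu x) a
  have hL := metricTrace_map (inducedMetric (productMetric g) (fun y => (u y, y)) x)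
    (fun b d => inducedMetric (productMetric g) (fun y => (u y, y)) x a b • d)
    (fderiv ℝ (fun y => (u y, y)) x : V →ₗ[ℝ] ℝ × V)
  rw [h] at hL
  simp only [ContinuousLinearMap.coe_coe, map_smul, fderiv_graph hu, inducedMetric_graph hu] at hL
  simp only [normalPart, tangentialPart, fderiv_graph hu, productMetric_apply, hL, sub_self]

/-- The second fundamental form of a graph is the Hessian of the height, times the normal part of
the vertical field: the remaining part of `∇_a (ψ_* b)` is `ψ_*` of a Christoffel symbol. -/
theorem secondFundamentalForm_graph (hg : IsRiemannianMetric g) (hu : ContDiff ℝ ∞ u)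
    (x a b : V) : secondFundamentalForm (productMetric g) (fun y => (u y, y)) x a b
      = hessian g u x a b • normalPart (productMetric g) (fun y => (u y, y)) x (1, 0) := by
  have hd : DifferentiableAt ℝ (fun y => fderiv ℝ u y b) x :=
    (((hu.fderiv_right (m := ∞) (by simp)).clm_apply contDiff_const).differentiable
      (by simp)).differentiableAt
  have h2 : fderiv ℝ (fun y => fderiv ℝ (fun y => (u y, y)) y b) x a
      = (fderiv ℝ (fun y => fderiv ℝ u y b) x a, 0) := by
    simp only [fderiv_graph hu]
    have h := (hd.hasFDerivAt.prodMk (hasFDerivAt_const b x)).fderiv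
    exact congrArg (fun L : V →L[ℝ] ℝ × V => L a) h
  simp only [secondFundamentalForm]
  rw [h2, christoffel_productMetric hg, fderiv_graph hu, fderiv_graph hu]
  have : ((fderiv ℝ (fun y => fderiv ℝ u y b) x a, 0) : ℝ × V) + (0, christoffel g x a b)
      = hessian g u x a b • ((1, 0) : ℝ × V)
        + (fderiv ℝ u x (christoffel g x a b), christoffel g x a b) := by
    simp [hessian]
  simp only [this, normalPart_add, normalPart_smul, normalPart_tangent hg hu, add_zero]

/-- As both sides of the soliton equation are multiples of the normal part of `∂_t`, the equation is
scalar for a graph. -/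
theorem isTranslatingSoliton_graph (hg : IsRiemannianMetric g) (hu : ContDiff ℝ ∞ u) {c : ℝ}
    (h : ∀ x, metricTrace (inducedMetric (productMetric g) (fun y => (u y, y)) x)
      (hessian g u x) = c) :
    IsTranslatingSoliton g c fun y => (u y, y) where
  smooth := hu.prodMk contDiff_id
  immersion x a b hab := by
    rw [fderiv_graph hu, fderiv_graph hu] at hab
    exact (Prod.ext_iff.1 hab).2
  soliton x := by
    have : secondFundamentalForm (productMetric g) (fun y => (u y, y)) x = fun a b =>
        hessian g u x a b • normalPart (productMetric g) (fun y => (u y, y)) x (1, 0) := by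
      ext1 a; ext1 b; exact secondFundamentalForm_graph hg hu x a b
    rw [meanCurvatureVector, this, metricTrace_smul_const, h]

end Graph

/-! ### Metrics in cylindrical form -/

section Cylindrical

open Filter Topology

variable {n : ℕ} {g : P n → LinearMap.BilinForm ℝ (P n)} {ξ χ : ℝ → ℝ}

theorem hasFDerivAt_norm_of_ne_zero {E : Type*} [NormedAddCommGroup E] [InnerProductSpace ℝ E]
    {y : E} (hy : y ≠ 0) : HasFDerivAt (fun x : E => ‖x‖) (‖y‖⁻¹ • innerSL ℝ y) y := by
  have h := (hasStrictFDerivAt_norm_sq y).hasFDerivAt.sqrt (by simpa using hy)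
  simp only [Real.sqrt_sq (norm_nonneg _)] at h
  convert h using 1
  ext x
  simp
  field_simp

theorem HasCylindricalForm.apply (hform : HasCylindricalForm g ξ χ) {τ ρ : ℝ} (hρ : ρ ≠ 0)
    {ϑ : EuclideanSpace ℝ (Fin (n - 1))} (hϑ : ‖ϑ‖ = 1) (v w : P n) :
    g (τ, ρ • ϑ) v w = ξ ρ ^ 2 * (v.1 * w.1) + inner ℝ ϑ v.2 * inner ℝ ϑ w.2
      + χ ρ ^ 2 / ρ ^ 2 * (inner ℝ v.2 w.2 - inner ℝ ϑ v.2 * inner ℝ ϑ w.2) := by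
  have hϑ' : inner ℝ ϑ ϑ = (1 : ℝ) := by rw [real_inner_self_eq_norm_sq, hϑ]; norm_num
  have hdec : ∀ v : EuclideanSpace ℝ (Fin (n - 1)),
      inner ℝ ϑ v • ϑ + ρ • (ρ⁻¹ • (v - inner ℝ ϑ v • ϑ)) = v := by
    intro v; rw [smul_smul, mul_inv_cancel₀ hρ, one_smul]; abel
  have hperp : ∀ v : EuclideanSpace ℝ (Fin (n - 1)),
      inner ℝ ϑ (ρ⁻¹ • (v - inner ℝ ϑ v • ϑ)) = 0 := by
    intro v; rw [inner_smul_right, inner_sub_right, inner_smul_right, hϑ']; ring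
  have h := hform τ ρ ϑ _ _ v.1 (inner ℝ ϑ v.2) w.1 (inner ℝ ϑ w.2) hϑ (hperp v.2) (hperp w.2)
  rw [hdec, hdec] at h
  change g (τ, ρ • ϑ) v w = _ at h
  rw [h]
  simp only [inner_smul_left, inner_smul_right, inner_sub_left, inner_sub_right, hϑ',
    real_inner_comm ϑ v.2, conj_trivial]
  field_simp
  ring

theorem HasCylindricalForm.apply_of_pos (hform : HasCylindricalForm g ξ χ) {p : P n}
    (hr : 0 < ‖p.2‖) (v w : P n) : g p v w = ξ ‖p.2‖ ^ 2 * (v.1 * w.1)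
      + inner ℝ p.2 v.2 * inner ℝ p.2 w.2 / ‖p.2‖ ^ 2 + χ ‖p.2‖ ^ 2 / ‖p.2‖ ^ 2
        * (inner ℝ v.2 w.2 - inner ℝ p.2 v.2 * inner ℝ p.2 w.2 / ‖p.2‖ ^ 2) := by
  have h := hform.apply (τ := p.1) hr.ne' (norm_smul_inv_norm (𝕜 := ℝ) (norm_pos_iff.1 hr)) v w
  change g (p.1, ‖p.2‖ • ‖p.2‖⁻¹ • p.2) v w = _ at h
  rw [smul_inv_smul₀ hr.ne'] at h
  change g p v w = _ at h
  rw [h]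
  simp only [RCLike.ofReal_real_eq_id, id, inner_smul_left, conj_trivial]
  field_simp

/-- The Gauss lemma: the radial field `(0, y)` represents the form `⟨y, dy⟩`. -/
theorem HasCylindricalForm.radial (hform : HasCylindricalForm g ξ χ) (q w : P n) :
    g q (0, q.2) w = inner ℝ q.2 w.2 := by
  obtain ⟨τ, y⟩ := q
  rcases eq_or_ne y 0 with rfl | hy
  · have : ((0, 0) : P n) = 0 := rfl
    simp [this]
  · have hr : ‖y‖ ≠ 0 := norm_ne_zero_iff.2 hy
    have hϑ : ‖‖y‖⁻¹ • y‖ = 1 := norm_smul_inv_norm (𝕜 := ℝ) hy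
    have h := hform.apply (τ := τ) hr hϑ (0, y) w
    rw [smul_inv_smul₀ hr] at h
    rw [h]
    simp only [inner_smul_left, real_inner_self_eq_norm_sq, conj_trivial]
    field_simp
    ring

theorem hasLineDerivAt_metric (hg : IsRiemannianMetric g) (p v w a : P n) :
    HasDerivAt (fun s : ℝ => g (p + s • a) v w) (fderiv ℝ (fun q => g q v w) p a) 0 :=
  (((hg.smooth v w).differentiable (by simp)).differentiableAt (x := p)).hasFDerivAt.hasLineDerivAt a

/-- The derivative of the identity `g(w, (0, y)) = ⟨y, w⟩`. -/
theorem HasCylindricalForm.fderiv_radial (hform : HasCylindricalForm g ξ χ)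
    (hg : IsRiemannianMetric g) (p v w : P n) :
    fderiv ℝ (fun q => g q w (0, p.2)) p v = inner ℝ v.2 w.2 - g p w (0, v.2) := by
  have h1 := (hasLineDerivAt_metric hg p w (0, p.2) v).add
    ((hasDerivAt_id (0 : ℝ)).mul (hasLineDerivAt_metric hg p w (0, v.2) v))
  have h2 : HasDerivAt (fun s : ℝ => inner ℝ p.2 w.2 + s * inner ℝ v.2 w.2)
      (1 * inner ℝ v.2 w.2) 0 := ((hasDerivAt_id (0 : ℝ)).mul_const _).const_add _
  have heq : (fun s : ℝ => inner ℝ p.2 w.2 + s * inner ℝ v.2 w.2)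
      = (fun s : ℝ => g (p + s • v) w (0, p.2)) + id * fun s : ℝ => g (p + s • v) w (0, v.2) := by
    ext s
    have h := hform.radial (p + s • v) w
    have hsplit : ((0, (p + s • v).2) : P n) = (0, p.2) + s • (0, v.2) := by simp
    rw [(hg.symm _ _ _), hsplit, map_add, map_smul] at h
    simp only [Pi.add_apply, Pi.mul_apply, id, smul_eq_mul] at h ⊢
    rw [h]
    simp [inner_add_left, inner_smul_left]
  rw [heq] at h2
  have := h1.unique h2
  simp at this
  linarith

/-- The derivative of the metric coefficients along a ray. -/
theorem HasCylindricalForm.fderiv_ray (hform : HasCylindricalForm g ξ χ)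
    (hg : IsRiemannianMetric g) (hreg : RegularCoefficients ξ χ) (p v w : P n)
    (hr : 0 < ‖p.2‖) :
    fderiv ℝ (fun q => g q v w) p (0, p.2)
      = 2 * ξ ‖p.2‖ * deriv ξ ‖p.2‖ * ‖p.2‖ * (v.1 * w.1)
        + (2 * χ ‖p.2‖ * deriv χ ‖p.2‖ / ‖p.2‖ - 2 * χ ‖p.2‖ ^ 2 / ‖p.2‖ ^ 2)
          * (inner ℝ v.2 w.2 - inner ℝ p.2 v.2 * inner ℝ p.2 w.2 / ‖p.2‖ ^ 2) := by
  obtain ⟨τ, y⟩ := p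
  simp only at hr ⊢
  set r := ‖y‖ with hrdef
  set ϑ := r⁻¹ • y with hϑdef
  have hy : y = r • ϑ := (smul_inv_smul₀ hr.ne' y).symm
  have hϑ : ‖ϑ‖ = 1 := norm_smul_inv_norm (𝕜 := ℝ) (norm_ne_zero_iff.1 hr.ne')
  have h1 := hasLineDerivAt_metric hg (τ, y) v w (0, y)
  set Q : ℝ := inner ℝ v.2 w.2 - inner ℝ ϑ v.2 * inner ℝ ϑ w.2 with hQ
  have hρ : HasDerivAt (fun s : ℝ => r + s * r) r 0 := by
    simpa using ((hasDerivAt_id (0 : ℝ)).mul_const r).const_add r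
  have hρ0 : r + 0 * r = r := by ring
  have hξ : HasDerivAt (fun s : ℝ => ξ (r + s * r)) (deriv ξ r * r) 0 :=
    HasDerivAt.comp (h₂ := ξ) 0 (by
      rw [hρ0]
      exact (hreg.smooth_xi.differentiable (by simp)).differentiableAt.hasDerivAt) hρ
  have hχ : HasDerivAt (fun s : ℝ => χ (r + s * r)) (deriv χ r * r) 0 :=
    HasDerivAt.comp (h₂ := χ) 0 (by
      rw [hρ0]
      exact (hreg.smooth_chi.differentiable (by simp)).differentiableAt.hasDerivAt) hρ
  have h2 := (((hξ.pow 2).mul_const (v.1 * w.1)).add_const (inner ℝ ϑ v.2 * inner ℝ ϑ w.2)).add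
    (((hχ.pow 2).div (hρ.pow 2) (by simp [hr.ne'])).mul_const Q)
  have heq : (fun s : ℝ => g ((τ, y) + s • (0, y)) v w) =ᶠ[𝓝 0] fun s =>
      ξ (r + s * r) ^ 2 * (v.1 * w.1) + inner ℝ ϑ v.2 * inner ℝ ϑ w.2
        + χ (r + s * r) ^ 2 / (r + s * r) ^ 2 * Q := by
    have : ∀ᶠ s : ℝ in 𝓝 0, r + s * r ≠ 0 :=
      hρ.continuousAt.eventually_ne (by simpa using hr.ne')
    filter_upwards [this] with s hs
    have hp : ((τ, y) + s • (0, y) : P n) = (τ, (r + s * r) • ϑ) := by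
      rw [Prod.smul_mk, Prod.mk_add_mk, add_smul, mul_smul, ← hy]; simp
    rw [hp]
    exact hform.apply hs hϑ v w
  have := h1.unique (h2.congr_of_eventuallyEq heq)
  rw [this]
  have hN : inner ℝ y v.2 * inner ℝ y w.2 / r ^ 2 = inner ℝ ϑ v.2 * inner ℝ ϑ w.2 := by
    rw [hy]; simp only [inner_smul_left, conj_trivial]; field_simp
  rw [hN]
  simp only [hρ0, ← hQ, Pi.pow_apply]
  push_cast
  field_simp

/-- The logarithmic derivative of the area of the equidistants, `Δ r` at distance `r`. -/
def areaLogDeriv (n : ℕ) (ξ χ : ℝ → ℝ) (r : ℝ) : ℝ :=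
  deriv ξ r / ξ r + ((n : ℝ) - 2) * (deriv χ r / χ r)

variable {U : P n → ℝ} {κ : ℝ → ℝ} {κ' : ℝ} {p : P n}

/-- The Christoffel symbol contributes only through `⟨y, Γ(v, w)⟩ = g((0, y), Γ(v, w))`, by the Gauss
lemma, and two of the three derivatives in it are known from `fderiv_radial`. -/
theorem hessian_eq_of_fderiv_eq (hform : HasCylindricalForm g ξ χ) (hg : IsRiemannianMetric g)
    (hU : ∀ w, fderiv ℝ U p w = κ ‖p.2‖ * inner ℝ p.2 w.2) (v w : P n) :
    hessian g U p v w = fderiv ℝ (fun q => fderiv ℝ U q w) p v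
      - κ ‖p.2‖ * inner ℝ v.2 w.2 + κ ‖p.2‖ / 2 * (g p w (0, v.2) + g p v (0, w.2)
        + fderiv ℝ (fun q => g q v w) p (0, p.2)) := by
  rw [hessian, hU, ← hform.radial, hg.symm, metric_christoffel hg, hform.fderiv_radial hg,
    hform.fderiv_radial hg, real_inner_comm v.2 w.2]
  ring

/-- The Hessian of a function of `r`, with radial derivative `r κ(r)`, for `r > 0`. -/
theorem hessian_radial (hform : HasCylindricalForm g ξ χ) (hg : IsRiemannianMetric g)
    (hreg : RegularCoefficients ξ χ)
    (hU : ∀ᶠ q in 𝓝 p, ∀ w, fderiv ℝ U q w = κ ‖q.2‖ * inner ℝ q.2 w.2)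
    (hκ : HasDerivAt κ κ' ‖p.2‖) (hr : 0 < ‖p.2‖) (v w : P n) :
    hessian g U p v w = κ ‖p.2‖ * ‖p.2‖ * (deriv χ ‖p.2‖ / χ ‖p.2‖) * g p v w
      + κ ‖p.2‖ * ‖p.2‖ * (deriv ξ ‖p.2‖ / ξ ‖p.2‖ - deriv χ ‖p.2‖ / χ ‖p.2‖)
        * (ξ ‖p.2‖ ^ 2 * (v.1 * w.1))
      + (κ' * ‖p.2‖ + κ ‖p.2‖ - κ ‖p.2‖ * ‖p.2‖ * (deriv χ ‖p.2‖ / χ ‖p.2‖)) / ‖p.2‖ ^ 2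
        * (inner ℝ p.2 v.2 * inner ℝ p.2 w.2) := by
  rw [hessian_eq_of_fderiv_eq hform hg hU.self_of_nhds, hform.fderiv_ray hg hreg p v w hr]
  have hp2 : p.2 ≠ 0 := norm_pos_iff.1 hr
  have hnorm : HasFDerivAt (fun q : P n => ‖q.2‖)
      ((‖p.2‖⁻¹ • innerSL ℝ p.2).comp (ContinuousLinearMap.snd ℝ ℝ _)) p :=
    (hasFDerivAt_norm_of_ne_zero hp2).comp p hasFDerivAt_snd
  have hD : fderiv ℝ (fun q => fderiv ℝ U q w) p v
      = κ' * (inner ℝ p.2 v.2 / ‖p.2‖) * inner ℝ p.2 w.2 + κ ‖p.2‖ * inner ℝ v.2 w.2 := by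
    have h1 : (fun q => fderiv ℝ U q w) =ᶠ[𝓝 p] fun q => κ ‖q.2‖ * inner ℝ q.2 w.2 :=
      hU.mono fun q hq => hq w
    have h2 : HasFDerivAt (fun q : P n => (inner ℝ q.2 w.2 : ℝ))
        ((innerSL ℝ w.2).comp (ContinuousLinearMap.snd ℝ ℝ _)) p := by
      have := ((innerSL ℝ w.2).comp
        (ContinuousLinearMap.snd ℝ ℝ (EuclideanSpace ℝ (Fin (n - 1))))).hasFDerivAt (x := p)
      refine this.congr_of_eventuallyEq (Eventually.of_forall fun q => ?_)
      simp [real_inner_comm]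
    have h3 : fderiv ℝ (fun q : P n => κ ‖q.2‖ * inner ℝ q.2 w.2) p = _ :=
      ((hκ.comp_hasFDerivAt p hnorm).mul h2).fderiv
    rw [h1.fderiv_eq, h3]
    simp [real_inner_comm]
    ring
  have hξ := (hreg.xi_pos _ hr).ne'
  have hχ := (hreg.chi_pos _ hr).ne'
  rw [hD, hform.apply_of_pos hr w, hform.apply_of_pos hr v (0, w.2), hform.apply_of_pos hr v w,
    real_inner_comm w.2 v.2]
  simp only [mul_zero]
  field_simp
  ring

/-- The trace of the Hessian with respect to `g + μ (r dr)²`: for `μ = 0` the Laplacian, for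
`μ = κ²` the trace with respect to the induced metric of the graph. -/
theorem metricTrace_hessian_radial (hn : 2 ≤ n) (hform : HasCylindricalForm g ξ χ)
    (hg : IsRiemannianMetric g) (hreg : RegularCoefficients ξ χ)
    (hU : ∀ᶠ q in 𝓝 p, ∀ w, fderiv ℝ U q w = κ ‖q.2‖ * inner ℝ q.2 w.2)
    (hκ : HasDerivAt κ κ' ‖p.2‖) (hr : 0 < ‖p.2‖) {B : LinearMap.BilinForm ℝ (P n)} {μ : ℝ}
    (hμ : 0 ≤ μ) (hB : ∀ v w, B v w = g p v w + μ * (inner ℝ p.2 v.2 * inner ℝ p.2 w.2)) :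
    metricTrace B (hessian g U p) = κ ‖p.2‖ * ‖p.2‖ * areaLogDeriv n ξ χ ‖p.2‖
      + (κ' * ‖p.2‖ + κ ‖p.2‖) / (1 + μ * ‖p.2‖ ^ 2) := by
  have hn' : ((n - 1 : ℕ) : ℝ) = (n : ℝ) - 1 := by push_cast [Nat.cast_sub (by omega : 1 ≤ n)]; rfl
  have hpos : ∀ v, v ≠ 0 → 0 < B v v := fun v hv => by
    rw [hB]
    have := hg.pos p v hv
    have := mul_nonneg hμ (mul_self_nonneg (inner ℝ p.2 v.2))
    linarith
  have hsymm : ∀ v w, B v w = B w v := fun v w => by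
    rw [hB, hB, hg.symm, mul_comm (inner ℝ p.2 v.2)]
  set r := ‖p.2‖ with hrdef
  set l := κ r * r * (deriv χ r / χ r) with hl
  have hμr : 1 + μ * r ^ 2 ≠ 0 := by positivity
  have hB1 : ∀ v, B (1, 0) v = ξ r ^ 2 * v.1 := fun v => by
    rw [hB, hform.apply_of_pos hr]; simp [hrdef]
  have hB2 : ∀ v, B (0, p.2) v = (1 + μ * r ^ 2) * inner ℝ p.2 v.2 := fun v => by
    rw [hB, hform.radial, real_inner_self_eq_norm_sq]; ring
  let α₁ : P n →ₗ[ℝ] ℝ := LinearMap.fst ℝ ℝ _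
  let α₂ : P n →ₗ[ℝ] ℝ := (innerₛₗ ℝ p.2).comp (LinearMap.snd ℝ ℝ _)
  have hT : hessian g U p = fun v w => l • B v w
      + ((κ r * r * (deriv ξ r / ξ r) - l) • (B (1, 0) v * α₁ w)
        + ((κ' * r + κ r - l * (1 + μ * r ^ 2)) / (r ^ 2 * (1 + μ * r ^ 2)))
          • (B (0, p.2) v * α₂ w)) := by
    ext v w
    have h1 : α₁ w = w.1 := rfl
    have h2 : α₂ w = inner ℝ p.2 w.2 := rfl
    rw [hessian_radial hform hg hreg hU hκ hr, hB1, hB2, hB, h1, h2]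
    simp only [smul_eq_mul, ← hrdef, ← hl]
    field_simp
    rw [hl]
    ring
  rw [hT, metricTrace_add, metricTrace_add, metricTrace_smul, metricTrace_smul, metricTrace_smul,
    metricTrace_self hpos hsymm, metricTrace_mul hpos, metricTrace_mul hpos]
  have h1 : α₁ (1, 0) = 1 := rfl
  have h2 : α₂ (0, p.2) = r ^ 2 := real_inner_self_eq_norm_sq p.2
  rw [h1, h2, Module.finrank_prod, Module.finrank_self, finrank_euclideanSpace_fin]
  simp only [smul_eq_mul, areaLogDeriv]
  push_cast
  rw [hn', hl]
  field_simp
  ring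

/-- The Hessian of a function of `r` on the geodesic `r = 0`, where its differential vanishes. -/
theorem metricTrace_hessian_center (hn : 2 ≤ n) (hform : HasCylindricalForm g ξ χ)
    (hg : IsRiemannianMetric g) (hp : p.2 = 0)
    (hU : ∀ q w, fderiv ℝ U q w = κ ‖q.2‖ * inner ℝ q.2 w.2) (hκ : Continuous κ) :
    metricTrace (g p) (hessian g U p) = κ 0 * ((n : ℝ) - 1) := by
  have hn' : ((n - 1 : ℕ) : ℝ) = (n : ℝ) - 1 := by push_cast [Nat.cast_sub (by omega : 1 ≤ n)]; rfl
  have hD : ∀ v w : P n, fderiv ℝ (fun q => fderiv ℝ U q w) p v = κ 0 * inner ℝ v.2 w.2 := by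
    intro v w
    let L : P n →L[ℝ] ℝ := κ 0 • (innerSL ℝ w.2).comp (ContinuousLinearMap.snd ℝ ℝ _)
    -- `κ(r)` need not be differentiable in `y`, but it multiplies a form vanishing at `y = 0`
    have h : HasFDerivAt (fun q : P n => κ ‖q.2‖ * inner ℝ q.2 w.2) L p := by
      rw [hasFDerivAt_iff_isLittleO]
      have h1 : (fun q : P n => κ ‖q.2‖ - κ 0) =o[𝓝 p] fun _ => (1 : ℝ) := by
        rw [Asymptotics.isLittleO_one_iff]
        have : Continuous fun q : P n => κ ‖q.2‖ - κ 0 := by fun_prop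
        simpa [hp] using this.tendsto p
      have h2 : (fun q : P n => inner ℝ w.2 (q - p).2) =O[𝓝 p] fun q => q - p :=
        ((innerSL ℝ w.2).comp (ContinuousLinearMap.snd ℝ ℝ
          (EuclideanSpace ℝ (Fin (n - 1))))).isBigO_comp (fun q : P n => q - p) _
      have h3 := h1.mul_isBigO h2.norm_right
      simp only [one_mul] at h3
      refine h3.of_norm_right.congr_left fun q => ?_
      simp [L, hp, real_inner_comm]
      ring
    simp only [hU]
    rw [h.fderiv]
    simp [L, real_inner_comm]
  let α₁ : P n →ₗ[ℝ] ℝ := LinearMap.fst ℝ ℝ _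
  have hG : ∀ v w : P n, g p w (0, v.2) = inner ℝ v.2 w.2 := fun v w => by
    have h := hform.fderiv_radial hg p v w
    have h0 : ((0, p.2) : P n) = 0 := by rw [hp]; rfl
    simp only [h0, map_zero, fderiv_fun_const, Pi.zero_apply, zero_apply] at h
    linarith
  have hT : hessian g U p = fun v w => κ 0 • g p v w + (-κ 0) • (g p (1, 0) v * α₁ w) := by
    ext v w
    have h1 : α₁ w = w.1 := rfl
    rw [hessian, hD, hU, hp, h1, real_inner_comm, ← hG, hg.symm p (1, 0)]
    have : w = w.1 • (1, 0) + (0, w.2) := by ext <;> simp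
    conv_rhs => rw [this]
    simp only [map_add, map_smul, smul_eq_mul, inner_zero_left]
    simp
    ring
  rw [hT, metricTrace_add, metricTrace_smul, metricTrace_smul, metricTrace_self (hg.pos p)
    (hg.symm p), metricTrace_mul (hg.pos p)]
  have h1 : α₁ (1, 0) = 1 := rfl
  rw [h1, Module.finrank_prod, Module.finrank_self, finrank_euclideanSpace_fin]
  push_cast
  rw [hn']
  simp only [smul_eq_mul]
  ring

theorem laplaceBeltrami_radius (hn : 2 ≤ n) (hform : HasCylindricalForm g ξ χ)
    (hg : IsRiemannianMetric g) (hreg : RegularCoefficients ξ χ) (hr : 0 < radius p) :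
    laplaceBeltrami g radius p = areaLogDeriv n ξ χ (radius p) := by
  have hU : ∀ᶠ q in 𝓝 p, ∀ w, fderiv ℝ (radius (n := n)) q w
      = (fun s : ℝ => s⁻¹) ‖q.2‖ * inner ℝ q.2 w.2 := by
    have : ∀ᶠ q : P n in 𝓝 p, q.2 ≠ 0 :=
      continuous_snd.continuousAt.eventually_ne (norm_pos_iff.1 hr)
    filter_upwards [this] with q hq w
    have h : HasFDerivAt (radius (n := n)) _ q :=
      (hasFDerivAt_norm_of_ne_zero hq).comp q hasFDerivAt_snd
    rw [h.fderiv]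
    simp
  have hr' : 0 < ‖p.2‖ := hr
  rw [laplaceBeltrami, metricTrace_hessian_radial hn hform hg hreg hU (hasDerivAt_inv hr'.ne') hr'
    le_rfl (by simp)]
  simp only [radius]
  field_simp
  ring

theorem isTranslatingSoliton_radial (hn : 2 ≤ n) (hform : HasCylindricalForm g ξ χ)
    (hg : IsRiemannianMetric g) (hreg : RegularCoefficients ξ χ) (hUs : ContDiff ℝ ∞ U)
    (hU : ∀ q w, fderiv ℝ U q w = κ ‖q.2‖ * inner ℝ q.2 w.2) (hκ : Differentiable ℝ κ) {c : ℝ}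
    (hc : κ 0 * ((n : ℝ) - 1) = c)
    (hODE : ∀ r, 0 < r → κ r * r * areaLogDeriv n ξ χ r
      + (deriv κ r * r + κ r) / (1 + κ r ^ 2 * r ^ 2) = c) :
    IsTranslatingSoliton g c (graphMap U) := by
  refine isTranslatingSoliton_graph hg hUs fun x => ?_
  rcases (norm_nonneg x.2).eq_or_lt with h0 | hr
  · have hx : x.2 = 0 := norm_eq_zero.1 h0.symm
    have : inducedMetric (productMetric g) (fun y => (U y, y)) x = g x := by
      refine LinearMap.ext fun v => LinearMap.ext fun w => ?_
      rw [inducedMetric_graph hUs, hU, hx]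
      simp
    rw [this, metricTrace_hessian_center hn hform hg hx hU hκ.continuous, hc]
  · rw [metricTrace_hessian_radial hn hform hg hreg (Eventually.of_forall hU)
      hκ.differentiableAt.hasDerivAt hr (sq_nonneg (κ ‖x.2‖)) fun v w => ?_, hODE _ hr]
    rw [inducedMetric_graph hUs, hU, hU]
    ring

end Cylindrical

/-! ### Weighted radial averages and even functions -/

section Averages

open Filter Topology MeasureTheory

/-- The weighted average `∫₀¹ tᵏ φ(r t) dt`, equal to `r^{-(k+1)} ∫₀ʳ sᵏ φ(s) ds` for `r ≠ 0`. -/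
def radialAverage (k : ℕ) (φ : ℝ → ℝ) (r : ℝ) : ℝ := ∫ t in (0 : ℝ)..1, t ^ k * φ (r * t)

theorem continuous_radialAverage {φ : ℝ → ℝ} (k : ℕ) (hφ : Continuous φ) :
    Continuous (radialAverage k φ) := by
  unfold radialAverage
  apply intervalIntegral.continuous_parametric_intervalIntegral_of_continuous'
  fun_prop

theorem hasDerivAt_radialAverage {φ : ℝ → ℝ} (k : ℕ) (hφ : ContDiff ℝ 1 φ) (r : ℝ) :
    HasDerivAt (radialAverage k φ) (radialAverage (k + 1) (deriv φ) r) r := by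
  have hd : Continuous (deriv φ) := hφ.continuous_deriv le_rfl
  have hF' : Continuous (Function.uncurry fun x t : ℝ => t ^ (k + 1) * deriv φ (x * t)) := by
    fun_prop
  obtain ⟨C, hC⟩ := ((isCompact_Icc (a := r - 1) (b := r + 1)).prod
    (isCompact_Icc (a := (0 : ℝ)) (b := 1))).exists_bound_of_continuousOn hF'.continuousOn
  refine (intervalIntegral.hasDerivAt_integral_of_dominated_loc_of_deriv_le
    (F := fun x t => t ^ k * φ (x * t)) (F' := fun x t => t ^ (k + 1) * deriv φ (x * t))
    (bound := fun _ => C) (s := Set.Icc (r - 1) (r + 1))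
    (Icc_mem_nhds (by linarith) (by linarith)) (Eventually.of_forall fun x => ?_) ?_ ?_
    (ae_of_all _ fun t ht x hx => ?_) (by simp) (ae_of_all _ fun t _ x _ => ?_)).2
  · exact (by have := hφ.continuous; fun_prop : Continuous _).aestronglyMeasurable
  · exact (by have := hφ.continuous; fun_prop : Continuous _).intervalIntegrable _ _
  · exact (by fun_prop : Continuous _).aestronglyMeasurable
  · rw [Set.uIoc_of_le zero_le_one] at ht
    exact hC (x, t) ⟨hx, ht.1.le, ht.2⟩
  · have h1 : HasDerivAt φ (deriv φ (x * t)) (x * t) :=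
      (hφ.differentiable (by simp)).differentiableAt.hasDerivAt
    have h2 : HasDerivAt (fun x => x * t) t x := by simpa using (hasDerivAt_id x).mul_const t
    exact ((h1.comp x h2).const_mul (t ^ k)).congr_deriv (by ring)

theorem contDiff_radialAverage {n : ℕ} : ∀ (k : ℕ) {φ : ℝ → ℝ}, ContDiff ℝ n φ →
    ContDiff ℝ n (radialAverage k φ) := by
  induction n with
  | zero =>
    intro k φ hφ
    exact contDiff_zero.2 (continuous_radialAverage k hφ.continuous)
  | succ n ih =>
    intro k φ hφ
    have hφ1 : ContDiff ℝ 1 φ := hφ.of_le (by simp)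
    have hd := fun r => hasDerivAt_radialAverage k hφ1 r
    push_cast at hφ ⊢
    rw [contDiff_succ_iff_deriv] at hφ ⊢
    refine ⟨fun r => (hd r).differentiableAt, by simp, ?_⟩
    rw [funext fun r => (hd r).deriv]
    exact ih (k + 1) hφ.2.2

/-- Substitution `s = r t`. -/
theorem pow_mul_radialAverage (k : ℕ) (φ : ℝ → ℝ) (r : ℝ) :
    r ^ (k + 1) * radialAverage k φ r = ∫ s in (0 : ℝ)..r, s ^ k * φ s := by
  have h := intervalIntegral.mul_integral_comp_mul_left (f := fun s => s ^ k * φ s)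
    (a := (0 : ℝ)) (b := 1) r
  simp only [mul_zero, mul_one] at h
  rw [← h, radialAverage, pow_succ', mul_assoc, ← intervalIntegral.integral_const_mul]
  congr 1
  refine intervalIntegral.integral_congr fun t _ => ?_
  simp only [mul_pow]
  ring

theorem hasDerivAt_pow_mul_radialAverage (k : ℕ) {φ : ℝ → ℝ} (hφ : Continuous φ) (r : ℝ) :
    HasDerivAt (fun r => r ^ (k + 1) * radialAverage k φ r) (r ^ k * φ r) r := by
  simp only [pow_mul_radialAverage]
  have hc : Continuous fun s => s ^ k * φ s := by fun_prop
  exact hc.deriv_integral _ 0 r ▸ (hc.integral_hasStrictDerivAt 0 r).hasDerivAt.congr_deriv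
    (hc.deriv_integral _ 0 r).symm

/-- Averaging composed with multiplication by `r²` gains one derivative. -/
theorem hasDerivAt_sq_mul_radialAverage (k : ℕ) {φ : ℝ → ℝ} (hφ : Continuous φ) (r : ℝ) :
    HasDerivAt (fun r => r ^ 2 * radialAverage (k + 2) φ r)
      (r * (φ r - (k + 1) * radialAverage (k + 2) φ r)) r := by
  have hA := continuous_radialAverage (k + 2) hφ
  rcases eq_or_ne r 0 with rfl | hr
  · rw [hasDerivAt_iff_isLittleO]
    simp only [zero_mul, sub_zero, smul_zero, ne_eq, OfNat.ofNat_ne_zero, not_false_eq_true,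
      zero_pow]
    have h1 : (fun r : ℝ => r * radialAverage (k + 2) φ r) =o[𝓝 0] fun _ => (1 : ℝ) := by
      rw [Asymptotics.isLittleO_one_iff]
      have : Continuous fun r : ℝ => r * radialAverage (k + 2) φ r := by fun_prop
      simpa using this.tendsto 0
    refine ((Asymptotics.isBigO_refl (fun r : ℝ => r) (𝓝 0)).mul_isLittleO h1).congr
      (fun r => by ring) fun r => by ring
  · have h1 := hasDerivAt_pow_mul_radialAverage (k + 2) hφ r
    have h2 := h1.div (hasDerivAt_pow (k + 1) r) (pow_ne_zero _ hr)
    refine (h2.congr_of_eventuallyEq ?_).congr_deriv ?_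
    · filter_upwards [isOpen_ne.mem_nhds hr] with s hs
      simp only [Pi.div_apply]
      field_simp
      ring
    · simp only [Nat.add_sub_cancel]
      push_cast
      field_simp
      ring

theorem contDiff_sq_mul_radialAverage {n : ℕ} (k : ℕ) {φ : ℝ → ℝ} (hφ : ContDiff ℝ n φ) :
    ContDiff ℝ (n + 1) fun r => r ^ 2 * radialAverage (k + 2) φ r := by
  have hd := fun r => hasDerivAt_sq_mul_radialAverage k hφ.continuous r
  rw [contDiff_succ_iff_deriv]
  refine ⟨fun r => (hd r).differentiableAt, by simp, ?_⟩
  rw [funext fun r => (hd r).deriv]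
  exact contDiff_id.mul (hφ.sub (contDiff_const.mul (contDiff_radialAverage _ hφ)))

theorem radialAverage_even (k : ℕ) {φ : ℝ → ℝ} (hφ : ∀ r, φ (-r) = φ r) (r : ℝ) :
    radialAverage k φ (-r) = radialAverage k φ r := by
  simp only [radialAverage, neg_mul, hφ]

/-- Hadamard's lemma. -/
theorem exists_contDiff_eq_mul {φ : ℝ → ℝ} (hφ : ContDiff ℝ ∞ φ) (h0 : φ 0 = 0) :
    ∃ ψ : ℝ → ℝ, ContDiff ℝ ∞ ψ ∧ (∀ r, φ r = r * ψ r) ∧ ψ 0 = deriv φ 0 := by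
  have hd : ContDiff ℝ ∞ (deriv φ) := (contDiff_infty_iff_deriv.1 hφ).2
  refine ⟨radialAverage 0 (deriv φ),
    contDiff_infty.2 fun n => contDiff_radialAverage 0 (contDiff_infty.1 hd n), fun r => ?_, ?_⟩
  · have h := pow_mul_radialAverage 0 (deriv φ) r
    simp only [zero_add, pow_one, pow_zero, one_mul] at h
    rw [h, intervalIntegral.integral_deriv_eq_sub
      (fun x _ => (hφ.differentiable (by simp)).differentiableAt)
      (hd.continuous.intervalIntegrable _ _), h0, sub_zero]
  · simp [radialAverage]

theorem deriv_neg_of_even {f : ℝ → ℝ} (hf : ∀ r, f (-r) = f r) (r : ℝ) :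
    deriv f (-r) = -deriv f r := by
  have h := deriv_comp_neg (f := f) r
  simp only [hf] at h
  linarith

/-- The gradient of a radial function. -/
theorem hasFDerivAt_comp_norm {E : Type*} [NormedAddCommGroup E] [InnerProductSpace ℝ E]
    {f κ : ℝ → ℝ} (hf : ∀ r, HasDerivAt f (r * κ r) r) (y : E) :
    HasFDerivAt (fun y : E => f ‖y‖) (κ ‖y‖ • innerSL ℝ y) y := by
  rcases eq_or_ne y 0 with rfl | hy
  · have h := hf 0
    rw [zero_mul, hasDerivAt_iff_isLittleO] at h
    rw [hasFDerivAt_iff_isLittleO]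
    have ht : Tendsto (fun y : E => ‖y‖) (𝓝 0) (𝓝 0) := by 
      simpa using continuous_norm.tendsto (0 : E)
    refine ((h.comp_tendsto ht).trans_isBigO ?_).congr_left fun y => by simp
    simpa [Function.comp_def] using (Asymptotics.isBigO_refl (fun y : E => y) (𝓝 0)).norm_left
  · refine ((hf ‖y‖).comp_hasFDerivAt y (hasFDerivAt_norm_of_ne_zero hy)).congr_fderiv ?_
    have : ‖y‖ ≠ 0 := norm_ne_zero_iff.2 hy
    rw [smul_smul]
    congr 1
    field_simp

/-- An even smooth function of the norm is smooth: by Hadamard's lemma its gradient is `κ(|y|) y` with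
`κ` again even and smooth, so one may induct on the order of differentiability. -/
theorem contDiff_comp_norm {E : Type*} [NormedAddCommGroup E] [InnerProductSpace ℝ E] {f : ℝ → ℝ}
    (hf : ContDiff ℝ ∞ f) (heven : ∀ r, f (-r) = f r) : ContDiff ℝ ∞ fun y : E => f ‖y‖ := by
  rw [contDiff_infty]
  intro n
  induction n generalizing f with
  | zero => exact contDiff_zero.2 (hf.continuous.comp continuous_norm)
  | succ n ih =>
    have hd : ContDiff ℝ ∞ (deriv f) := (contDiff_infty_iff_deriv.1 hf).2
    have h0 : deriv f 0 = 0 := by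
      have := deriv_neg_of_even heven 0
      rw [neg_zero] at this
      linarith
    obtain ⟨κ, hκ, hκf, -⟩ := exists_contDiff_eq_mul hd h0
    have hκe : ∀ r, κ (-r) = κ r := by
      have hne : ∀ r, r ≠ 0 → κ (-r) = κ r := fun r hr => by
        have := deriv_neg_of_even heven r
        rw [hκf, hκf] at this
        exact mul_left_cancel₀ hr (by linarith)
      intro r
      rcases eq_or_ne r 0 with rfl | hr
      · simp
      · exact hne r hr
    have hfd := fun y : E => hasFDerivAt_comp_norm (f := f) (κ := κ) (fun r => hκf r ▸
      (hf.differentiable (by simp)).differentiableAt.hasDerivAt) y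
    push_cast
    rw [contDiff_succ_iff_fderiv]
    refine ⟨fun y => (hfd y).differentiableAt, by simp, ?_⟩
    rw [funext fun y => (hfd y).fderiv]
    exact (ih hκ hκe).smul (innerSL ℝ).contDiff

end Averages

/-! ### A Volterra fixed point theorem -/

section Volterra

open Filter Topology MeasureTheory

theorem integral_exp_mul_mul {lam x : ℝ} (hl : 0 < lam) :
    x * ∫ t in (0 : ℝ)..1, Real.exp (lam * (x * t)) = (Real.exp (lam * x) - 1) / lam := by
  have h := intervalIntegral.mul_integral_comp_mul_left (f := fun s => Real.exp (lam * s))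
    (a := (0 : ℝ)) (b := 1) x
  rw [h]
  have h2 := intervalIntegral.mul_integral_comp_mul_left (f := fun s => Real.exp s)
    (a := (0 : ℝ)) (b := x) lam
  simp only [mul_zero, mul_one, integral_exp, Real.exp_zero] at h2 ⊢
  rw [eq_div_iff hl.ne', ← h2, mul_comm]

/-- A Volterra operator on the continuous functions on the line has a fixed point: it is a
contraction for the norm `sup e^{-lam |r|} |z(r)|` if `lam` is large. -/
theorem exists_fixedPoint_of_volterra {T : (ℝ → ℝ) → ℝ → ℝ} {C K : ℝ} (hC : 0 ≤ C) (hK : 0 ≤ K)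
    (hT : ∀ z, Continuous z → Continuous (T z)) (hb : ∀ z, Continuous z → ∀ r, |T z r| ≤ C * |r|)
    (hL : ∀ z y, Continuous z → Continuous y → ∀ r,
      |T z r - T y r| ≤ K * (|r| * ∫ t in (0 : ℝ)..1, |z (|r| * t) - y (|r| * t)|)) :
    ∃ z, Continuous z ∧ T z = z := by
  obtain ⟨lam, hlam⟩ : ∃ lam : ℝ, lam = 2 * K + 1 := ⟨_, rfl⟩
  have hl : 0 < lam := by rw [hlam]; positivity
  obtain ⟨lift, hlift_apply⟩ : ∃ lift : BoundedContinuousFunction ℝ ℝ → ℝ → ℝ,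
      ∀ Z r, lift Z r = Real.exp (lam * |r|) * Z r := ⟨_, fun _ _ => rfl⟩
  have hlift : ∀ Z, Continuous (lift Z) := fun Z => by
    have := Z.continuous
    rw [funext (hlift_apply Z)]
    fun_prop
  have hexp : ∀ r : ℝ, Real.exp (-(lam * |r|)) * Real.exp (lam * |r|) = 1 := fun r => by
    rw [← Real.exp_add]; simp
  have hS_exists : ∀ Z : BoundedContinuousFunction ℝ ℝ, ∃ Z' : BoundedContinuousFunction ℝ ℝ,
      ∀ r, Z' r = Real.exp (-(lam * |r|)) * T (lift Z) r := fun Z => by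
    refine ⟨BoundedContinuousFunction.ofNormedAddCommGroup
      (fun r => Real.exp (-(lam * |r|)) * T (lift Z) r)
      (by have := hT _ (hlift Z); fun_prop) (C / lam) (fun r => ?_), fun r => rfl⟩
    rw [norm_mul, Real.norm_eq_abs, Real.norm_eq_abs, Real.abs_exp]
    have h1 : lam * |r| ≤ Real.exp (lam * |r|) := by
      linarith [Real.add_one_le_exp (lam * |r|)]
    calc Real.exp (-(lam * |r|)) * |T (lift Z) r|
        ≤ Real.exp (-(lam * |r|)) * (C * |r|) := by
          gcongr
          exact hb _ (hlift Z) r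
      _ = C / lam * (Real.exp (-(lam * |r|)) * (lam * |r|)) := by field_simp
      _ ≤ C / lam * (Real.exp (-(lam * |r|)) * Real.exp (lam * |r|)) := by gcongr
      _ = C / lam := by rw [hexp, mul_one]
  choose S hS_apply using hS_exists
  have hS : ContractingWith (1 / 2) S := by
    refine ⟨by
      rw [← NNReal.coe_lt_coe]; norm_num, LipschitzWith.of_dist_le_mul fun Z Y => ?_⟩
    rw [BoundedContinuousFunction.dist_le (by positivity)]
    intro r
    obtain ⟨d, hd⟩ : ∃ d, d = dist Z Y := ⟨_, rfl⟩
    have hd0 : 0 ≤ d := hd ▸ dist_nonneg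
    rw [← hd]
    have hZY : ∀ t ∈ Set.Icc (0 : ℝ) 1, |lift Z (|r| * t) - lift Y (|r| * t)|
        ≤ Real.exp (lam * (|r| * t)) * d := fun t ht => by
      have h0 : |(|r| * t)| = |r| * t := abs_of_nonneg (mul_nonneg (abs_nonneg r) ht.1)
      simp only [hlift_apply, h0, ← mul_sub, abs_mul, Real.abs_exp]
      rw [hd]
      gcongr
      exact BoundedContinuousFunction.dist_coe_le_dist (f := Z) (g := Y) (|r| * t)
    have hint : |r| * ∫ t in (0 : ℝ)..1, |lift Z (|r| * t) - lift Y (|r| * t)|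
        ≤ Real.exp (lam * |r|) / lam * d := by
      have h1 : ∫ t in (0 : ℝ)..1, |lift Z (|r| * t) - lift Y (|r| * t)|
          ≤ ∫ t in (0 : ℝ)..1, Real.exp (lam * (|r| * t)) * d := by
        refine intervalIntegral.integral_mono_on zero_le_one ?_ ?_ hZY
        · have h1 := hlift Z
          have h2 := hlift Y
          exact (by fun_prop : Continuous _).intervalIntegrable _ _
        · exact (by fun_prop : Continuous _).intervalIntegrable _ _
      calc _ ≤ |r| * ∫ t in (0 : ℝ)..1, Real.exp (lam * (|r| * t)) * d := by gcongr
        _ = (Real.exp (lam * |r|) - 1) / lam * d := by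
          rw [intervalIntegral.integral_mul_const, ← mul_assoc, integral_exp_mul_mul hl]
        _ ≤ _ := by gcongr; linarith
    rw [Real.dist_eq, hS_apply, hS_apply, ← mul_sub, abs_mul, Real.abs_exp]
    calc Real.exp (-(lam * |r|)) * |T (lift Z) r - T (lift Y) r|
        ≤ Real.exp (-(lam * |r|)) * (K * (Real.exp (lam * |r|) / lam * d)) := by
          gcongr
          exact (hL _ _ (hlift Z) (hlift Y) r).trans (by gcongr)
      _ = (Real.exp (-(lam * |r|)) * Real.exp (lam * |r|)) * (K / lam * d) := by ring
      _ ≤ _ := by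
        rw [hexp, one_mul]
        gcongr
        rw [div_le_iff₀ hl]
        push_cast
        linarith
  refine ⟨lift hS.fixedPoint, hlift _, ?_⟩
  have hfix : S hS.fixedPoint = hS.fixedPoint := hS.fixedPoint_isFixedPt
  ext r
  have h := congrArg (fun Z : BoundedContinuousFunction ℝ ℝ => Z r) hfix
  simp only [hS_apply] at h
  rw [hlift_apply, ← h, ← mul_assoc, mul_comm (Real.exp (lam * |r|)), hexp, one_mul]

end Volterra

/-! ### The sine of the angle of the profile curve -/

section Angle

open Filter Topology MeasureTheory

/-- The function `√(1 - z²)`, with `|z|` truncated at `b`. -/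
def truncatedCos (b z : ℝ) : ℝ := √(1 - min |z| b ^ 2)

theorem continuous_truncatedCos (b : ℝ) : Continuous (truncatedCos b) := by
  unfold truncatedCos
  fun_prop

theorem abs_truncatedCos_le_one (b z : ℝ) : |truncatedCos b z| ≤ 1 := by
  rw [truncatedCos, abs_of_nonneg (Real.sqrt_nonneg _), Real.sqrt_le_one]
  nlinarith [sq_nonneg (min |z| b)]

theorem truncatedCos_of_abs_le {b z : ℝ} (h : |z| ≤ b) : truncatedCos b z = √(1 - z ^ 2) := by
  rw [truncatedCos, min_eq_left h, sq_abs]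

theorem abs_truncatedCos_sub_le {b : ℝ} (hb0 : 0 ≤ b) (hb : b < 1) (z y : ℝ) :
    |truncatedCos b z - truncatedCos b y| ≤ 1 / √(1 - b ^ 2) * |z - y| := by
  have hs : 0 < √(1 - b ^ 2) := Real.sqrt_pos.2 (by nlinarith)
  have hx : ∀ z : ℝ, √(1 - b ^ 2) ≤ truncatedCos b z ∧
      truncatedCos b z ^ 2 = 1 - min |z| b ^ 2 := fun z => by
    have h1 : min |z| b ≤ b := min_le_right _ _
    have h2 : 0 ≤ min |z| b := le_min (abs_nonneg _) hb0
    exact ⟨Real.sqrt_le_sqrt (by nlinarith), Real.sq_sqrt (by nlinarith)⟩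
  obtain ⟨hz1, hz2⟩ := hx z
  obtain ⟨hy1, hy2⟩ := hx y
  have hmin : |min |z| b - min |y| b| ≤ |z - y| :=
    (abs_min_sub_min_le_max _ _ _ _).trans (by simpa using abs_abs_sub_abs_le z y)
  have h3 : 0 ≤ min |z| b := le_min (abs_nonneg _) hb0
  have h4 : 0 ≤ min |y| b := le_min (abs_nonneg _) hb0
  have h5 : min |z| b ≤ 1 := (min_le_right _ _).trans hb.le
  have h6 : min |y| b ≤ 1 := (min_le_right _ _).trans hb.le
  have key : |truncatedCos b z - truncatedCos b y| * (truncatedCos b z + truncatedCos b y)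
      = |min |z| b - min |y| b| * (min |z| b + min |y| b) := by
    rw [← abs_of_pos (by linarith : 0 < truncatedCos b z + truncatedCos b y), ← abs_mul,
      ← abs_of_nonneg (by linarith : 0 ≤ min |z| b + min |y| b), ← abs_mul,
      ← abs_neg ((min |z| b - min |y| b) * _)]
    congr 1
    linear_combination hz2 - hy2
  rw [one_div, ← div_eq_inv_mul, le_div_iff₀ hs]
  nlinarith [abs_nonneg (truncatedCos b z - truncatedCos b y), abs_nonneg (min |z| b - min |y| b)]

end Angle

/-! ### The translating soliton equation for the angle -/

section Soliton

open Filter Topology MeasureTheory Set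

/-- The function `rᵏ j(r)` has the properties of the area density `ξ(r) χ(r)ᵏ` of the equidistants
of a geodesic in dimension `k + 2`, where `j = ξ (χ / r)ᵏ`: the factor `j` is even, smooth and
positive, and the logarithmic derivative `H(r) = k / r + j' / j` of the density is positive for
`r > 0`. -/
structure IsAreaDensity (k : ℕ) (j : ℝ → ℝ) : Prop where
  smooth : ContDiff ℝ ∞ j
  even : ∀ r, j (-r) = j r
  pos : ∀ r, 0 < j r
  logDeriv_pos : ∀ r, 0 < r → 0 < k / r + deriv j r / j r

variable {k : ℕ} {j : ℝ → ℝ} {c : ℝ}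

theorem IsAreaDensity.hasDerivAt_area (hj : IsAreaDensity k j) {r : ℝ} (hr : r ≠ 0) :
    HasDerivAt (fun r => r ^ k * j r) ((k / r + deriv j r / j r) * (r ^ k * j r)) r := by
  have h := (hasDerivAt_pow k r).mul
    ((hj.smooth.differentiable (by simp)).differentiableAt (x := r)).hasDerivAt
  refine h.congr_deriv ?_
  have := (hj.pos r).ne'
  rcases k with _ | k
  · simp; field_simp
  · simp only [Nat.add_sub_cancel]
    field_simp
    push_cast
    ring

theorem IsAreaDensity.monotoneOn_area (hj : IsAreaDensity k j) :
    MonotoneOn (fun r => r ^ k * j r) (Ici 0) := by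
  have hc := hj.smooth.continuous
  refine monotoneOn_of_deriv_nonneg (convex_Ici 0) (by fun_prop) ?_ ?_
  · intro r hr
    rw [interior_Ici] at hr
    exact (hj.hasDerivAt_area (ne_of_gt hr)).differentiableAt.differentiableWithinAt
  · intro r hr
    rw [interior_Ici] at hr
    rw [(hj.hasDerivAt_area (ne_of_gt hr)).deriv]
    have := hj.logDeriv_pos r hr
    have := hj.pos r
    have : 0 < r := hr
    positivity

theorem IsAreaDensity.abs (hj : IsAreaDensity k j) (r : ℝ) : j |r| = j r := by
  rcases abs_choice r with h | h <;> rw [h]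
  exact hj.even r

/-- The area density at `r t` is at most the one at `r`. -/
theorem IsAreaDensity.pow_mul_le (hj : IsAreaDensity k j) (r : ℝ) {t : ℝ} (ht : t ∈ Icc (0 : ℝ) 1) :
    t ^ k * j (r * t) ≤ j r := by
  rcases eq_or_ne r 0 with rfl | hr
  · rw [zero_mul]
    exact mul_le_of_le_one_left (hj.pos 0).le (pow_le_one₀ ht.1 ht.2)
  · have hr' : 0 < |r| := abs_pos.2 hr
    have h := hj.monotoneOn_area (mem_Ici.2 (mul_nonneg hr'.le ht.1)) (mem_Ici.2 hr'.le)
      (mul_le_of_le_one_right hr'.le ht.2)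
    simp only [mul_pow] at h
    have h2 : j (|r| * t) = j (r * t) := by
      rw [← hj.abs (r * t), abs_mul, abs_of_nonneg ht.1]
    rw [h2, hj.abs, mul_assoc] at h
    exact le_of_mul_le_mul_left h (pow_pos hr' k)

/-- The integral operator `z ↦ c (rᵏ j)⁻¹ ∫₀ʳ sᵏ j φ ds`, where `φ` is the cosine of the angle. -/
def angleOperator (k : ℕ) (j : ℝ → ℝ) (c : ℝ) (φ : ℝ → ℝ) (r : ℝ) : ℝ :=
  c * r * radialAverage k (fun s => j s * φ s) r / j r

theorem IsAreaDensity.continuous_angleOperator (hj : IsAreaDensity k j) {φ : ℝ → ℝ}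
    (hφ : Continuous φ) : Continuous (angleOperator k j c φ) := by
  have h1 := hj.smooth.continuous
  have h2 := continuous_radialAverage k (h1.mul hφ)
  exact ((continuous_const.mul continuous_id).mul h2).div h1 fun r => (hj.pos r).ne'

/-- The operator is bounded by the average of `φ`, as the area is monotone. -/
theorem IsAreaDensity.abs_angleOperator_le (hj : IsAreaDensity k j) (hc : 0 ≤ c) {φ : ℝ → ℝ}
    (hφ : Continuous φ) (r : ℝ) :
    |angleOperator k j c φ r| ≤ c * (|r| * ∫ t in (0 : ℝ)..1, |φ (r * t)|) := by
  have hjc := hj.smooth.continuous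
  have hjr := hj.pos r
  have h : |radialAverage k (fun s => j s * φ s) r| ≤ j r * ∫ t in (0 : ℝ)..1, |φ (r * t)| := by
    rw [← intervalIntegral.integral_const_mul]
    refine (intervalIntegral.abs_integral_le_integral_abs zero_le_one).trans ?_
    refine intervalIntegral.integral_mono_on zero_le_one
      ((by fun_prop : Continuous _).intervalIntegrable _ _)
      ((by fun_prop : Continuous _).intervalIntegrable _ _) fun t ht => ?_
    have h1 := hj.pow_mul_le r ht
    have h2 : 0 ≤ t ^ k * j (r * t) := mul_nonneg (pow_nonneg ht.1 k) (hj.pos _).le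
    rw [← mul_assoc, abs_mul, abs_of_nonneg h2]
    gcongr
  rw [angleOperator, abs_div, abs_mul, abs_mul, abs_of_nonneg hc, abs_of_pos hjr, div_le_iff₀ hjr]
  calc c * |r| * |radialAverage k (fun s => j s * φ s) r|
      ≤ c * |r| * (j r * ∫ t in (0 : ℝ)..1, |φ (r * t)|) := by gcongr
    _ = _ := by ring

theorem IsAreaDensity.abs_angleOperator_le_of_le_one (hj : IsAreaDensity k j) (hc : 0 ≤ c)
    {φ : ℝ → ℝ} (hφ : Continuous φ) (h1 : ∀ s, |φ s| ≤ 1) (r : ℝ) :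
    |angleOperator k j c φ r| ≤ c * |r| := by
  refine (hj.abs_angleOperator_le hc hφ r).trans ?_
  have : ∫ t in (0 : ℝ)..1, |φ (r * t)| ≤ ∫ t in (0 : ℝ)..1, (1 : ℝ) :=
    intervalIntegral.integral_mono_on zero_le_one
      ((by fun_prop : Continuous _).intervalIntegrable _ _) (by simp) fun t _ => h1 _
  simp only [intervalIntegral.integral_const, sub_zero, smul_eq_mul, mul_one] at this
  gcongr
  exact mul_le_of_le_one_right (abs_nonneg r) this

theorem IsAreaDensity.angleOperator_sub (hj : IsAreaDensity k j) {φ φ' : ℝ → ℝ}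
    (hφ : Continuous φ) (hφ' : Continuous φ') (r : ℝ) :
    angleOperator k j c φ r - angleOperator k j c φ' r
      = angleOperator k j c (fun s => φ s - φ' s) r := by
  have hjc := hj.smooth.continuous
  have : radialAverage k (fun s => j s * (φ s - φ' s)) r
      = radialAverage k (fun s => j s * φ s) r - radialAverage k (fun s => j s * φ' s) r := by
    simp only [radialAverage]
    rw [← intervalIntegral.integral_sub ((by fun_prop : Continuous _).intervalIntegrable _ _)
      ((by fun_prop : Continuous _).intervalIntegrable _ _)]
    simp only [mul_sub]
  simp only [angleOperator, this]
  ring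

theorem IsAreaDensity.angleOperator_odd (hj : IsAreaDensity k j) {φ : ℝ → ℝ}
    (hφ : ∀ r, φ (-r) = φ r) (r : ℝ) : angleOperator k j c φ (-r) = -angleOperator k j c φ r := by
  simp only [angleOperator, hj.even]
  rw [radialAverage_even k (fun s => by simp only [hj.even, hφ])]
  ring

theorem IsAreaDensity.angleOperator_nonneg (hj : IsAreaDensity k j) (hc : 0 ≤ c) {φ : ℝ → ℝ}
    (hφ : ∀ r, 0 ≤ φ r) {r : ℝ} (hr : 0 ≤ r) : 0 ≤ angleOperator k j c φ r := by
  have : 0 ≤ radialAverage k (fun s => j s * φ s) r :=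
    intervalIntegral.integral_nonneg zero_le_one fun t ht =>
      mul_nonneg (pow_nonneg ht.1 k) (mul_nonneg (hj.pos _).le (hφ _))
  have := hj.pos r
  unfold angleOperator
  positivity

theorem angleOperator_congr {φ φ' : ℝ → ℝ} {r : ℝ}
    (h : ∀ s, |s| ≤ |r| → φ s = φ' s) : angleOperator k j c φ r = angleOperator k j c φ' r := by
  unfold angleOperator
  congr 2
  refine intervalIntegral.integral_congr fun t ht => ?_
  rw [uIcc_of_le zero_le_one] at ht
  have : |r * t| ≤ |r| := by
    rw [abs_mul, abs_of_nonneg ht.1]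
    exact mul_le_of_le_one_right (abs_nonneg r) ht.2
  simp only [h _ this]

theorem IsAreaDensity.hasDerivAt_angleOperator (hj : IsAreaDensity k j) {φ : ℝ → ℝ}
    (hφ : Continuous φ) {r : ℝ} (hr : 0 < r) :
    HasDerivAt (angleOperator k j c φ)
      (c * φ r - (k / r + deriv j r / j r) * angleOperator k j c φ r) r := by
  have hjc := hj.smooth.continuous
  have hjr := (hj.pos r).ne'
  have hjφ : Continuous fun s => j s * φ s := hjc.mul hφ
  have h1 := ((hasDerivAt_pow_mul_radialAverage k hjφ r).const_mul c).div
    (hj.hasDerivAt_area hr.ne') (mul_ne_zero (pow_ne_zero k hr.ne') hjr)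
  refine (h1.congr_of_eventuallyEq ?_).congr_deriv ?_
  · filter_upwards [isOpen_ne.mem_nhds hr.ne'] with s hs
    have := (hj.pos s).ne'
    have hs' : s ≠ 0 := hs
    simp only [angleOperator, Pi.div_apply]
    field_simp
    ring
  · simp only [angleOperator]
    field_simp
    ring

/-- The truncated equation has a global solution. -/
theorem IsAreaDensity.exists_truncated (hj : IsAreaDensity k j) (hc : 0 ≤ c) {b : ℝ} (hb0 : 0 ≤ b)
    (hb : b < 1) : ∃ z : ℝ → ℝ, Continuous z ∧ (∀ r, z (-r) = -z r) ∧
      z = angleOperator k j c fun s => truncatedCos b (z s) := by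
  have hcos : ∀ {z : ℝ → ℝ}, Continuous z → Continuous fun s => truncatedCos b (z |s|) :=
    fun hz => (continuous_truncatedCos b).comp (hz.comp continuous_abs)
  obtain ⟨z, hz, hfix⟩ := exists_fixedPoint_of_volterra
    (T := fun z => angleOperator k j c fun s => truncatedCos b (z |s|)) (C := c)
    (K := c * (1 / √(1 - b ^ 2))) hc (by positivity)
    (fun z hz => hj.continuous_angleOperator (hcos hz))
    (fun z hz r => hj.abs_angleOperator_le_of_le_one hc (hcos hz)
      (fun s => abs_truncatedCos_le_one _ _) r)
    (fun z y hz hy r => by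
      rw [hj.angleOperator_sub (hcos hz) (hcos hy)]
      refine (hj.abs_angleOperator_le hc (φ := fun s => truncatedCos b (z |s|)
        - truncatedCos b (y |s|)) ((hcos hz).sub (hcos hy)) r).trans ?_
      have : ∫ t in (0 : ℝ)..1, |truncatedCos b (z |r * t|) - truncatedCos b (y |r * t|)|
          ≤ ∫ t in (0 : ℝ)..1, 1 / √(1 - b ^ 2) * |z (|r| * t) - y (|r| * t)| := by
        refine intervalIntegral.integral_mono_on zero_le_one ?_ ?_ fun t ht => ?_
        · have h1 := continuous_truncatedCos b
          exact (by fun_prop : Continuous fun t =>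
            |truncatedCos b (z |r * t|) - truncatedCos b (y |r * t|)|).intervalIntegrable _ _
        · exact (by fun_prop : Continuous _).intervalIntegrable _ _
        · rw [abs_mul, abs_of_nonneg ht.1]
          exact abs_truncatedCos_sub_le hb0 hb _ _
      rw [intervalIntegral.integral_const_mul] at this
      calc _ ≤ c * (|r| * (1 / √(1 - b ^ 2) * ∫ t in (0 : ℝ)..1, |z (|r| * t) - y (|r| * t)|)) := by
            gcongr
        _ = _ := by ring)
  have hodd : ∀ r, z (-r) = -z r := fun r => by
    conv_lhs => rw [← hfix]
    conv_rhs => rw [← hfix]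
    exact hj.angleOperator_odd (fun s => by rw [abs_neg]) r
  have habs : ∀ s, truncatedCos b (z |s|) = truncatedCos b (z s) := fun s => by
    rcases abs_choice s with h | h <;> rw [h]
    rw [hodd, truncatedCos, truncatedCos, abs_neg]
  exact ⟨z, hz, hodd, by simpa only [habs] using hfix.symm⟩

/-- `z` solves, on `[-R, R]`, the integral form of `z' = c √(1 - z²) - H z`, which is the
translating soliton equation for `z = f' / √(1 + f'²)`. -/
structure SolvesAngle (k : ℕ) (j : ℝ → ℝ) (c R : ℝ) (z : ℝ → ℝ) : Prop where
  continuous : Continuous z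
  odd : ∀ r, z (-r) = -z r
  nonneg : ∀ r, 0 ≤ r → 0 ≤ z r
  lt_one : ∀ r, 0 ≤ r → r ≤ R → z r < 1
  eq : ∀ r, |r| ≤ R → z r = angleOperator k j c (fun s => √(1 - z s ^ 2)) r

/-- A solution on `[-R, R]`: truncate the cosine at a height `b < 1` that no solution exceeds.
Near `r = 0` this holds as `z ≤ c r`; away from `0`, where `H` is bounded below, it suffices that
`c √(1 - b²) < H b`, so that `z' < 0` wherever `z = b`. -/
theorem IsAreaDensity.exists_solvesAngle (hj : IsAreaDensity k j) (hc : 0 ≤ c) (R : ℝ) :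
    ∃ z, SolvesAngle k j c R z := by
  set ε : ℝ := 1 / (2 * (c + 1)) with hε
  have hε0 : 0 < ε := by positivity
  have hdc : Continuous (deriv j) := hj.smooth.continuous_deriv (by simp)
  obtain ⟨η, hη0, hη⟩ : ∃ η > 0, ∀ r ∈ Icc ε R, η ≤ k / r + deriv j r / j r := by
    have hcont : ContinuousOn (fun r => k / r + deriv j r / j r) (Icc ε R) := by
      refine ContinuousOn.add (continuousOn_const.div continuousOn_id fun r hr => ?_)
        (hdc.continuousOn.div hj.smooth.continuous.continuousOn fun r _ => (hj.pos r).ne')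
      exact (hε0.trans_le hr.1).ne'
    rcases (Icc ε R).eq_empty_or_nonempty with he | hne
    · exact ⟨1, one_pos, fun r hr => by simp [he] at hr⟩
    · obtain ⟨r₀, hr₀, hmin⟩ := isCompact_Icc.exists_isMinOn hne hcont
      exact ⟨_, hj.logDeriv_pos r₀ (hε0.trans_le hr₀.1), fun r hr => hmin hr⟩
  obtain ⟨b, hb2, hb1, hbη⟩ : ∃ b : ℝ, 1 / 2 ≤ b ∧ b < 1 ∧ c * √(1 - b ^ 2) < η * b := by
    have h1 : ∀ᶠ b : ℝ in 𝓝[<] 1, c * √(1 - b ^ 2) < η * b := by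
      have : Tendsto (fun b : ℝ => η * b - c * √(1 - b ^ 2)) (𝓝[<] 1)
          (𝓝 (η * 1 - c * √(1 - 1 ^ 2))) :=
        ((by fun_prop : Continuous fun b : ℝ => η * b - c * √(1 - b ^ 2)).tendsto 1).mono_left
          nhdsWithin_le_nhds
      filter_upwards [this.eventually_const_lt (u := 0) (by simpa using hη0)] with b hb
      linarith
    have h2 : ∀ᶠ b : ℝ in 𝓝[<] 1, 1 / 2 < b ∧ b < 1 :=
      Ioo_mem_nhdsLT (by norm_num)
    obtain ⟨b, hb, hb'⟩ := (h1.and h2).exists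
    exact ⟨b, hb'.1.le, hb'.2, hb⟩
  obtain ⟨z, hz, hodd, hfix⟩ := hj.exists_truncated hc (b := b) (by linarith) hb1
  have hcos : Continuous fun s => truncatedCos b (z s) := (continuous_truncatedCos b).comp hz
  have hnn : ∀ r, 0 ≤ r → 0 ≤ z r := fun r hr => by
    rw [hfix]
    exact hj.angleOperator_nonneg hc (fun s => Real.sqrt_nonneg _) hr
  have hder : ∀ r, 0 < r →
      HasDerivAt z (c * truncatedCos b (z r) - (k / r + deriv j r / j r) * z r) r := fun r hr => by
    have h := hj.hasDerivAt_angleOperator (c := c) hcos hr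
    rwa [← hfix] at h
  have hsmall : ∀ r, 0 ≤ r → r ≤ ε → z r ≤ b := fun r hr hrε => by
    have h1 : |z r| ≤ c * |r| := by
      rw [hfix]
      exact hj.abs_angleOperator_le_of_le_one hc hcos (fun s => abs_truncatedCos_le_one _ _) r
    have h2 : c * ε ≤ 1 / 2 := by
      rw [hε, mul_one_div, div_le_iff₀ (by positivity)]
      linarith
    calc z r ≤ |z r| := le_abs_self _
      _ ≤ c * |r| := h1
      _ ≤ c * ε := by rw [abs_of_nonneg hr]; gcongr
      _ ≤ b := h2.trans hb2
  have hle : ∀ r, 0 ≤ r → r ≤ R → z r ≤ b := fun r hr hrR => by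
    rcases le_total r ε with h | h
    · exact hsmall r hr h
    · refine image_le_of_deriv_right_lt_deriv_boundary (f := z)
        (f' := fun r => c * truncatedCos b (z r) - (k / r + deriv j r / j r) * z r)
        (a := ε) (b := R) (B := fun _ => b) (B' := fun _ => 0) hz.continuousOn
        (fun x hx => (hder x (hε0.trans_le hx.1)).hasDerivWithinAt) (hsmall ε hε0.le le_rfl)
        (fun x => hasDerivAt_const x b) (fun x hx hxb => ?_) ⟨h, hrR⟩
      have hb0 : |b| ≤ b := (abs_of_nonneg (by linarith)).le
      simp only [hxb, truncatedCos_of_abs_le hb0]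
      have := hη x ⟨hx.1, hx.2.le⟩
      nlinarith
  refine ⟨z, hz, hodd, hnn, fun r hr hrR => (hle r hr hrR).trans_lt hb1, fun r hr => ?_⟩
  conv_lhs => rw [hfix]
  refine angleOperator_congr fun s hs => truncatedCos_of_abs_le ?_
  have h1 : |z s| = z |s| := by
    rcases le_total 0 s with h | h
    · rw [abs_of_nonneg h, abs_of_nonneg (hnn s h)]
    · rw [abs_of_nonpos h, hodd, abs_of_nonpos]
      have := hnn (-s) (by linarith)
      rw [hodd] at this
      linarith
  rw [h1]
  exact hle _ (abs_nonneg s) (hs.trans hr)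

end Soliton

/-! ### Global solutions and their smoothness on the axis -/

section Global

open Filter Topology Set

variable {k : ℕ} {j : ℝ → ℝ} {c R : ℝ} {z y : ℝ → ℝ}

theorem SolvesAngle.mono (h : SolvesAngle k j c R z) {R' : ℝ} (hR : R' ≤ R) :
    SolvesAngle k j c R' z :=
  ⟨h.continuous, h.odd, h.nonneg, fun r hr hr' => h.lt_one r hr (hr'.trans hR),
    fun r hr => h.eq r (hr.trans hR)⟩

theorem SolvesAngle.hasDerivAt (h : SolvesAngle k j c R z) (hj : IsAreaDensity k j) {r : ℝ}
    (hr : 0 < r) (hrR : r < R) :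
    HasDerivAt z (c * √(1 - z r ^ 2) - (k / r + deriv j r / j r) * z r) r := by
  have hc : Continuous fun s => √(1 - z s ^ 2) := by
    have := h.continuous
    fun_prop
  rw [h.eq r (by rw [abs_of_pos hr]; exact hrR.le)]
  have h1 := hj.hasDerivAt_angleOperator (c := c) hc hr
  have h2 := h.eq r (by rw [abs_of_pos hr]; exact hrR.le)
  rw [← h2] at h1 ⊢
  refine h1.congr_of_eventuallyEq ?_
  filter_upwards [Ioo_mem_nhds hr hrR] with s hs
  exact h.eq s (by rw [abs_of_pos hs.1]; exact hs.2.le)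

theorem SolvesAngle.zero (h : SolvesAngle k j c R z) : z 0 = 0 := by
  have := h.odd 0
  rw [neg_zero] at this
  linarith

theorem SolvesAngle.sq_lt_one (h : SolvesAngle k j c R z) {r : ℝ} (hr : |r| ≤ R) :
    z r ^ 2 < 1 := by
  have h0 := h.nonneg |r| (abs_nonneg r)
  have h1 := h.lt_one |r| (abs_nonneg r) hr
  have h2 : z |r| ^ 2 = z r ^ 2 := by
    rcases abs_choice r with h' | h' <;> rw [h']
    rw [h.odd, neg_sq]
  nlinarith

/-- The square of the difference of two solutions is nonincreasing, as `√(1 - z²)` decreases in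
`z ≥ 0` and `H > 0`. -/
theorem SolvesAngle.eq_of_nonneg (hz : SolvesAngle k j c R z) (hy : SolvesAngle k j c R y)
    (hj : IsAreaDensity k j) (hc : 0 ≤ c) {r : ℝ} (hr : 0 ≤ r) (hrR : r ≤ R) : z r = y r := by
  have hanti : AntitoneOn (fun r => (z r - y r) ^ 2) (Icc 0 R) := by
    have hzc := hz.continuous
    have hyc := hy.continuous
    have hd : ∀ s ∈ interior (Icc 0 R), HasDerivAt (fun r => (z r - y r) ^ 2) _ s := fun s hs => by
      rw [interior_Icc] at hs
      exact ((hz.hasDerivAt hj hs.1 hs.2).sub (hy.hasDerivAt hj hs.1 hs.2)).pow 2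
    refine antitoneOn_of_deriv_nonpos (convex_Icc 0 R) (by fun_prop)
      (fun s hs => (hd s hs).differentiableAt.differentiableWithinAt) fun s hs => ?_
    rw [(hd s hs).deriv]
    rw [interior_Icc] at hs
    have hH := hj.logDeriv_pos s hs.1
    have hz0 := hz.nonneg s hs.1.le
    have hy0 := hy.nonneg s hs.1.le
    have hmono : (z s - y s) * (√(1 - z s ^ 2) - √(1 - y s ^ 2)) ≤ 0 := by
      rcases le_total (z s) (y s) with h | h
      · exact mul_nonpos_of_nonpos_of_nonneg (sub_nonpos.2 h)
          (sub_nonneg.2 (Real.sqrt_le_sqrt (by nlinarith)))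
      · exact mul_nonpos_of_nonneg_of_nonpos (sub_nonneg.2 h)
          (sub_nonpos.2 (Real.sqrt_le_sqrt (by nlinarith)))
    have h1 := mul_nonneg hc (neg_nonneg.2 hmono)
    have h2 := mul_nonneg hH.le (sq_nonneg (z s - y s))
    simp only [Nat.cast_ofNat, Nat.add_one_sub_one, pow_one, Pi.sub_apply]
    nlinarith
  have h := hanti ⟨le_rfl, hr.trans hrR⟩ ⟨hr, hrR⟩ hr
  simp only [hz.zero, hy.zero, sub_zero, ne_eq, OfNat.ofNat_ne_zero, not_false_eq_true,
    zero_pow] at h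
  have := pow_eq_zero_iff (two_ne_zero) |>.1 (le_antisymm h (sq_nonneg _))
  linarith

theorem SolvesAngle.eq_of_abs_le (hz : SolvesAngle k j c R z) (hy : SolvesAngle k j c R y)
    (hj : IsAreaDensity k j) (hc : 0 ≤ c) {r : ℝ} (hr : |r| ≤ R) : z r = y r := by
  rcases le_total 0 r with h | h
  · exact hz.eq_of_nonneg hy hj hc h ((le_abs_self r).trans hr)
  · have := hz.eq_of_nonneg hy hj hc (neg_nonneg.2 h) ((neg_le_abs r).trans hr)
    rw [hz.odd, hy.odd] at this
    linarith

/-- By uniqueness, the solutions on `[-N, N]` fit together. -/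
theorem IsAreaDensity.exists_global (hj : IsAreaDensity k j) (hc : 0 ≤ c) :
    ∃ z, ∀ R, SolvesAngle k j c R z := by
  choose Z hZ using fun N : ℕ => hj.exists_solvesAngle hc (N : ℝ)
  let z : ℝ → ℝ := fun r => Z ⌈|r|⌉₊ r
  have heq : ∀ (N : ℕ) (r : ℝ), |r| ≤ N → z r = Z N r := fun N r hr => by
    have h1 : ⌈|r|⌉₊ ≤ N := Nat.ceil_le.2 hr
    exact (hZ _).eq_of_abs_le ((hZ N).mono (by exact_mod_cast h1)) hj hc (Nat.le_ceil _)
  refine ⟨z, fun R => ⟨?_, fun r => ?_, fun r hr => (hZ _).nonneg r hr, fun r hr _ =>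
    (hZ _).lt_one r hr ((le_abs_self r).trans (Nat.le_ceil _)), fun r _ => ?_⟩⟩
  · rw [continuous_iff_continuousAt]
    intro r
    obtain ⟨N, hN⟩ := exists_nat_gt |r|
    refine (hZ N).continuous.continuousAt.congr ?_
    filter_upwards [(isOpen_lt continuous_abs continuous_const).mem_nhds hN] with s hs
    exact (heq N s (le_of_lt hs)).symm
  · simp only [z, abs_neg]
    exact (hZ _).odd r
  · have h := (hZ ⌈|r|⌉₊).eq r (Nat.le_ceil _)
    change Z ⌈|r|⌉₊ r = _
    rw [h]
    refine angleOperator_congr fun s hs => ?_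
    rw [heq ⌈|r|⌉₊ s (hs.trans (Nat.le_ceil _))]

/-- A solution is `r ζ(r)` with `ζ` smooth. The integral equation for `ζ` reads
`j ζ = c (A_k j - r² A_{k+2} φ)`, with `φ` a smooth function of `r` and `ζ`, and `r² A_{k+2}`
gains one derivative. -/
theorem SolvesAngle.exists_contDiff_eq_mul (hj : IsAreaDensity k j)
    (hz : ∀ R, SolvesAngle k j c R z) :
    ∃ ζ : ℝ → ℝ, ContDiff ℝ ∞ ζ ∧ (∀ r, z r = r * ζ r) ∧ (∀ r, ζ (-r) = ζ r) ∧
      ζ 0 = c / (k + 1) := by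
  have hzc : Continuous z := (hz 0).continuous
  have hjc := hj.smooth.continuous
  have hsq : ∀ r, z r ^ 2 < 1 := fun r => (hz |r|).sq_lt_one le_rfl
  let ζ : ℝ → ℝ := fun r => c * radialAverage k (fun s => j s * √(1 - z s ^ 2)) r / j r
  have hzζ : ∀ r, z r = r * ζ r := fun r => by
    rw [(hz |r|).eq r le_rfl, angleOperator]
    simp only [ζ]
    ring
  let φ : ℝ → ℝ := fun r => j r * (ζ r ^ 2 / (1 + √(1 - (r * ζ r) ^ 2)))
  have hζc : Continuous ζ := by
    have := continuous_radialAverage k (by fun_prop : Continuous fun s => j s * √(1 - z s ^ 2))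
    exact (continuous_const.mul this).div hjc fun r => (hj.pos r).ne'
  have hφ_contDiff : ∀ {n : ℕ}, ContDiff ℝ n ζ → ContDiff ℝ n φ := fun {n} hζ => by
    have hjn : ContDiff ℝ n j := contDiff_infty.1 hj.smooth n
    have h1 : ContDiff ℝ n fun r => √(1 - (r * ζ r) ^ 2) :=
      (contDiff_const.sub ((contDiff_id.mul hζ).pow 2)).sqrt fun r => by
        have := hsq r
        rw [hzζ] at this
        simp only [id]
        linarith
    exact hjn.mul ((hζ.pow 2).div (contDiff_const.add h1) fun r => by positivity)
  have hφc : Continuous φ := (hφ_contDiff (n := 0) (contDiff_zero.2 hζc)).continuous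
  have hζ_eq : ζ = fun r => c * (radialAverage k j r - r ^ 2 * radialAverage (k + 2) φ r) / j r := by
    ext r
    simp only [ζ]
    congr 2
    have h1 : r ^ 2 * radialAverage (k + 2) φ r = radialAverage k (fun s => s ^ 2 * φ s) r := by
      simp only [radialAverage]
      rw [← intervalIntegral.integral_const_mul]
      exact intervalIntegral.integral_congr fun t _ => by ring
    rw [h1]
    simp only [radialAverage]
    rw [← intervalIntegral.integral_sub ((by fun_prop : Continuous _).intervalIntegrable _ _)
      ((by fun_prop : Continuous _).intervalIntegrable _ _)]
    refine intervalIntegral.integral_congr fun t _ => ?_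
    simp only [φ]
    rw [← mul_sub, hzζ]
    set s := r * t
    have h2 : √(1 - (s * ζ s) ^ 2) ^ 2 = 1 - (s * ζ s) ^ 2 := Real.sq_sqrt (by
      have := hsq s
      rw [hzζ] at this
      linarith)
    have h3 : 1 + √(1 - (s * ζ s) ^ 2) ≠ 0 := by positivity
    simp only [mul_pow] at h2 h3 ⊢
    congr 1
    field_simp
    linear_combination j s * h2
  have hζn : ∀ n : ℕ, ContDiff ℝ n ζ := fun n => by
    induction n with
    | zero => exact contDiff_zero.2 hζc
    | succ n ih =>
      push_cast
      rw [hζ_eq]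
      have hjn : ContDiff ℝ (n + 1) j := by exact_mod_cast contDiff_infty.1 hj.smooth (n + 1)
      have hA : ContDiff ℝ (n + 1) (radialAverage k j) := by
        exact_mod_cast contDiff_radialAverage k (contDiff_infty.1 hj.smooth (n + 1))
      exact (contDiff_const.mul (hA.sub (contDiff_sq_mul_radialAverage k (hφ_contDiff ih)))).div hjn
        fun r => (hj.pos r).ne'
  refine ⟨ζ, contDiff_infty.2 hζn, hzζ, fun r => ?_, ?_⟩
  · simp only [ζ, hj.even]
    rw [radialAverage_even k fun s => by rw [hj.even, (hz 0).odd, neg_sq]]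
  · have : radialAverage k j 0 = j 0 / (k + 1) := by
      simp [radialAverage, integral_pow]
      ring
    rw [hζ_eq]
    simp only [this]
    have := (hj.pos 0).ne'
    field_simp
    ring

/-- The radial derivative `f' = r κ(r)` of a rotationally symmetric translating soliton. -/
theorem IsAreaDensity.exists_profile_of_nonneg (hj : IsAreaDensity k j) (hc : 0 ≤ c) :
    ∃ κ : ℝ → ℝ, ContDiff ℝ ∞ κ ∧ (∀ r, κ (-r) = κ r) ∧ κ 0 * (k + 1) = c ∧
      ∀ r, 0 < r → κ r * r * (k / r + deriv j r / j r)
        + (deriv κ r * r + κ r) / (1 + κ r ^ 2 * r ^ 2) = c := by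
  obtain ⟨z, hz⟩ := hj.exists_global hc
  obtain ⟨ζ, hζ, hzζ, hζe, hζ0⟩ := SolvesAngle.exists_contDiff_eq_mul hj hz
  have hsq : ∀ r, (r * ζ r) ^ 2 < 1 := fun r => by
    rw [← hzζ]
    exact (hz |r|).sq_lt_one le_rfl
  have hspos : ∀ r, 0 < √(1 - (r * ζ r) ^ 2) := fun r => Real.sqrt_pos.2 (by linarith [hsq r])
  let κ : ℝ → ℝ := fun r => ζ r / √(1 - (r * ζ r) ^ 2)
  have hκ : ContDiff ℝ ∞ κ := by
    refine hζ.div ((contDiff_const.sub ((contDiff_id.mul hζ).pow 2)).sqrt fun r => ?_)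
      fun r => (hspos r).ne'
    have := hsq r
    simp only [id]
    linarith
  refine ⟨κ, hκ, fun r => by simp only [κ, hζe, neg_mul, neg_sq], ?_, fun r hr => ?_⟩
  · simp only [κ, zero_mul, hζ0]
    field_simp
    simp
  · have hz' := (hz (r + 1)).hasDerivAt hj hr (by linarith)
    set s := √(1 - z r ^ 2) with hs
    have hs0 : 0 < s := by rw [hs, hzζ]; exact hspos r
    have hs2 : s ^ 2 = 1 - z r ^ 2 := Real.sq_sqrt (by rw [hzζ]; linarith [hsq r])
    set D := c * s - (k / r + deriv j r / j r) * z r with hD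
    have h1 : HasDerivAt (fun r => 1 - z r ^ 2) (-(2 * z r * D)) r := by
      simpa using (hz'.pow 2).const_sub 1
    have h2 := hz'.div (h1.sqrt (by rw [← hs2]; positivity)) hs0.ne'
    have h3 : HasDerivAt (fun r => r * κ r) (1 * κ r + r * deriv κ r) r :=
      (hasDerivAt_id r).mul (hκ.differentiable (by simp)).differentiableAt.hasDerivAt
    have h4 : (fun r => r * κ r) = fun r => z r / √(1 - z r ^ 2) := by
      ext r
      simp only [κ, hzζ]
      ring
    rw [h4] at h3
    have h5 := h3.unique h2
    rw [← hs] at h5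
    have h6 : κ r * r = z r / s := by
      rw [mul_comm]
      exact congrFun h4 r
    have h7 : 1 + κ r ^ 2 * r ^ 2 = 1 / s ^ 2 := by
      rw [← mul_pow, h6]
      field_simp
      linarith
    have h8 : deriv κ r * r + κ r = D / s ^ 3 := by
      rw [show deriv κ r * r + κ r = 1 * κ r + r * deriv κ r by ring, h5]
      field_simp
      linear_combination D * hs2
    rw [h7, h8, h6, hD]
    field_simp
    ring

theorem IsAreaDensity.exists_profile (hj : IsAreaDensity k j) (c : ℝ) :
    ∃ κ : ℝ → ℝ, ContDiff ℝ ∞ κ ∧ (∀ r, κ (-r) = κ r) ∧ κ 0 * (k + 1) = c ∧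
      ∀ r, 0 < r → κ r * r * (k / r + deriv j r / j r)
        + (deriv κ r * r + κ r) / (1 + κ r ^ 2 * r ^ 2) = c := by
  rcases le_total 0 c with hc | hc
  · exact hj.exists_profile_of_nonneg hc
  · obtain ⟨κ, h1, h2, h3, h4⟩ := hj.exists_profile_of_nonneg (neg_nonneg.2 hc)
    refine ⟨fun r => -κ r, h1.neg, fun r => by simp only [h2], by linarith, fun r hr => ?_⟩
    have h := h4 r hr
    rw [deriv.fun_neg, neg_sq]
    rw [← neg_eq_iff_eq_neg] at h
    rw [← h]
    ring

end Global

/-! ### The area density of the equidistants -/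

section Density

open Set

variable {n : ℕ} {g : P n → LinearMap.BilinForm ℝ (P n)} {ξ χ : ℝ → ℝ}

/-- A continuous function with even square which is positive on `[0, ∞)` has no zero, hence
constant sign, and is even. -/
theorem even_and_pos_of_sq_even {q : ℝ → ℝ} (hq : Continuous q) (hpos : ∀ r, 0 ≤ r → 0 < q r)
    (hsq : ∀ r, 0 < r → q (-r) ^ 2 = q r ^ 2) : ∀ r, q (-r) = q r ∧ 0 < q r := by
  have hp : ∀ r, 0 < q r := by
    intro r
    by_contra! h
    have hr : r ≤ 0 := by
      by_contra! hr
      exact (hpos r hr.le).not_ge h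
    obtain ⟨s, hs, hs0⟩ := intermediate_value_Icc hr hq.continuousOn ⟨h, (hpos 0 le_rfl).le⟩
    rcases hs.2.eq_or_lt with rfl | hs'
    · exact (hpos 0 le_rfl).ne' hs0
    · have h1 := hsq (-s) (by linarith)
      have h2 := hpos (-s) (by linarith)
      rw [neg_neg, hs0] at h1
      nlinarith
  have he : ∀ r, 0 < r → q (-r) = q r := fun r hr =>
    (pow_left_inj₀ (hp _).le (hp _).le two_ne_zero).1 (hsq r hr)
  intro r
  refine ⟨?_, hp r⟩
  rcases lt_trichotomy r 0 with h | h | h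
  · have := he (-r) (by linarith)
    rw [neg_neg] at this
    exact this.symm
  · simp [h]
  · exact he r h

/-- The cylindrical coordinates `(r, ϑ)` and `(-r, -ϑ)` describe the same point. -/
theorem HasCylindricalForm.sq_even (hform : HasCylindricalForm g ξ χ) {r : ℝ} (hr : r ≠ 0)
    {ϑ : EuclideanSpace ℝ (Fin (n - 1))} (hϑ : ‖ϑ‖ = 1) :
    ξ (-r) ^ 2 = ξ r ^ 2 ∧ ∀ η : EuclideanSpace ℝ (Fin (n - 1)), ‖η‖ = 1 → inner ℝ ϑ η = 0 →
      χ (-r) ^ 2 = χ r ^ 2 := by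
  have key : ∀ v, g (0, r • ϑ) v v = g (0, (-r) • (-ϑ)) v v := fun v => by
    rw [neg_smul_neg]
  have hϑ' : ‖-ϑ‖ = 1 := by rwa [norm_neg]
  constructor
  · have h := key (1, 0)
    rw [hform.apply hr hϑ, hform.apply (neg_ne_zero.2 hr) hϑ'] at h
    simp at h
    exact h.symm
  · intro η hη hperp
    have h := key (0, η)
    rw [hform.apply hr hϑ, hform.apply (neg_ne_zero.2 hr) hϑ'] at h
    simp only [mul_zero, hperp, inner_neg_left, neg_zero, real_inner_self_eq_norm_sq, hη] at h
    field_simp at h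
    linarith

/-- The coefficients of the metric define a density `j = ξ (χ / r)^(n-2)`. It is even because the form
of the metric is required for negative `r` as well. -/
theorem exists_isAreaDensity (hn : 2 ≤ n) (hg : IsRiemannianMetric g)
    (hreg : RegularCoefficients ξ χ) (hform : HasCylindricalForm g ξ χ)
    (hpos : ∀ x : P n, 0 < radius x → 0 < equidistantMeanCurvature g x) :
    ∃ j : ℝ → ℝ, IsAreaDensity (n - 2) j ∧ ∀ r, 0 < r →
      ((n - 2 : ℕ) : ℝ) / r + deriv j r / j r = areaLogDeriv n ξ χ r := by
  have hn1 : (0 : ℝ) < (n : ℝ) - 1 := by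
    have : (2 : ℝ) ≤ n := by exact_mod_cast hn
    linarith
  let ϑ : EuclideanSpace ℝ (Fin (n - 1)) := EuclideanSpace.single ⟨0, by omega⟩ 1
  have hϑ : ‖ϑ‖ = 1 := by simp [ϑ]
  have hχ0 : χ 0 = 0 := by simpa using hreg.chi_even 0
  obtain ⟨ψ, hψ, hχψ, hψ0⟩ := exists_contDiff_eq_mul hreg.smooth_chi hχ0
  rw [hreg.chi_deriv] at hψ0
  have hξe := even_and_pos_of_sq_even hreg.smooth_xi.continuous
    (fun r hr => hr.eq_or_lt.elim (fun h => by rw [← h, hreg.xi_zero]; exact one_pos)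
      (hreg.xi_pos r))
    (fun r hr => (hform.sq_even hr.ne' hϑ).1)
  have hψe : 0 < n - 2 → ∀ r, ψ (-r) = ψ r ∧ 0 < ψ r := fun hk => by
    refine even_and_pos_of_sq_even hψ.continuous (fun r hr => ?_) fun r hr => ?_
    · rcases hr.eq_or_lt with h | h
      · rw [← h, hψ0]; exact one_pos
      · have := hreg.chi_pos r h
        rw [hχψ] at this
        exact pos_of_mul_pos_right this hr
    · -- in dimension at least three there is a direction tangent to the sphere
      have h := (hform.sq_even hr.ne' hϑ).2 (EuclideanSpace.single ⟨1, by omega⟩ 1) (by simp)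
        (by simp [ϑ, EuclideanSpace.inner_single_left])
      rw [hχψ, hχψ, mul_pow, mul_pow, neg_sq] at h
      exact mul_left_cancel₀ (pow_ne_zero 2 hr.ne') h
  have hψk : ∀ r, ψ (-r) ^ (n - 2) = ψ r ^ (n - 2) ∧ 0 < ψ r ^ (n - 2) := fun r => by
    rcases Nat.eq_zero_or_pos (n - 2) with h | h
    · simp [h]
    · rw [(hψe h r).1]
      exact ⟨rfl, pow_pos (hψe h r).2 _⟩
  have hlog : ∀ r, 0 < r → ((n - 2 : ℕ) : ℝ) / r + deriv (fun r => ξ r * ψ r ^ (n - 2)) r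
      / (ξ r * ψ r ^ (n - 2)) = areaLogDeriv n ξ χ r := fun r hr => by
    have hξ' := (hreg.smooth_xi.differentiable (by simp)).differentiableAt (x := r) |>.hasDerivAt
    have hψ' := (hψ.differentiable (by simp)).differentiableAt (x := r) |>.hasDerivAt
    have hχ' : deriv χ r = 1 * ψ r + r * deriv ψ r := by
      rw [funext hχψ]
      exact ((hasDerivAt_id r).mul hψ').deriv
    have hψr : ψ r ≠ 0 := fun h => by
      have := hreg.chi_pos r hr
      rw [hχψ, h, mul_zero] at this
      exact this.ne rfl
    have hξr := (hξe r).2.ne'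
    have hd : deriv (fun r => ξ r * ψ r ^ (n - 2)) r = _ := (hξ'.mul (hψ'.pow (n - 2))).deriv
    rw [hd, areaLogDeriv, hχ', hχψ]
    obtain ⟨k, rfl⟩ := Nat.exists_eq_add_of_le hn
    rw [Nat.add_sub_cancel_left]
    push_cast
    rcases k with _ | k
    · simp
    · simp only [Nat.add_sub_cancel, Pi.pow_apply]
      push_cast
      field_simp
      ring
  refine ⟨fun r => ξ r * ψ r ^ (n - 2), ⟨hreg.smooth_xi.mul (hψ.pow _), fun r => ?_, fun r =>
    mul_pos (hξe r).2 (hψk r).2, fun r hr => ?_⟩, hlog⟩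
  · simp only [(hξe r).1, (hψk r).1]
  · rw [hlog r hr]
    have hx : radius ((0, r • ϑ) : P n) = r := by
      simp [radius, norm_smul, hϑ, abs_of_pos hr]
    have h := hpos (0, r • ϑ) (by rwa [hx])
    rw [equidistantMeanCurvature, laplaceBeltrami_radius hn hform hg hreg (by rwa [hx]), hx] at h
    exact (div_pos_iff_of_pos_right hn1).1 h

end Density

end GrimReaper

end

theorem mainTheorem9 (n : ℕ) (hn : 2 ≤ n)
    (g : GrimReaper.P n → LinearMap.BilinForm ℝ (GrimReaper.P n)) (ξ χ : ℝ → ℝ)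
    (hg : GrimReaper.IsRiemannianMetric g)
    (hreg : GrimReaper.RegularCoefficients ξ χ)
    (hform : GrimReaper.HasCylindricalForm g ξ χ)
    (hK : ∀ x v w : GrimReaper.P n, LinearIndependent ℝ ![v, w] →
      GrimReaper.sectionalCurvature g x v w < 0)
    (hpos : ∀ x : GrimReaper.P n, 0 < GrimReaper.radius x →
      0 < GrimReaper.equidistantMeanCurvature g x)
    (hlim : ∃ L : ℝ, Filter.Tendsto (GrimReaper.equidistantMeanCurvature g)
      (Filter.comap GrimReaper.radius Filter.atTop) (nhds L))
    (c : ℝ) :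
    ∃ u : GrimReaper.P n → ℝ,
      GrimReaper.IsTranslatingSoliton g c (GrimReaper.graphMap u) ∧
      GrimReaper.FoliatedByEquidistants (Set.range (GrimReaper.graphMap u)) ∧
      ∃ f : ℝ → ℝ, ContDiff ℝ ∞ f ∧ (∀ x, u x = f (GrimReaper.radius x)) ∧
        ∀ x : GrimReaper.P n, 0 < GrimReaper.radius x →
          deriv (deriv f) (GrimReaper.radius x)
            = (1 + deriv f (GrimReaper.radius x) ^ 2)
              * (c - ((n : ℝ) - 1) * GrimReaper.equidistantMeanCurvature g x
                * deriv f (GrimReaper.radius x)) := by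
  obtain ⟨j, hj, hlog⟩ := GrimReaper.exists_isAreaDensity hn hg hreg hform hpos
  obtain ⟨κ, hκ, hκe, hκ0, hODE⟩ := hj.exists_profile c
  have hn1 : ((n - 2 : ℕ) : ℝ) + 1 = (n : ℝ) - 1 := by
    rw [Nat.cast_sub hn]
    push_cast
    ring
  have hn0 : (n : ℝ) - 1 ≠ 0 := by
    rw [← hn1]
    positivity
  have hκd : Differentiable ℝ κ := hκ.differentiable (by simp)
  -- `f(r) = ∫₀ʳ s κ(s) ds`
  let f : ℝ → ℝ := fun r => r ^ 2 * GrimReaper.radialAverage 1 κ r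
  have hf' : ∀ r, HasDerivAt f (r * κ r) r := fun r => by
    simpa using GrimReaper.hasDerivAt_pow_mul_radialAverage 1 hκ.continuous r
  have hdf : deriv f = fun r => r * κ r := funext fun r => (hf' r).deriv
  have hf : ContDiff ℝ ∞ f := by
    rw [contDiff_infty_iff_deriv, hdf]
    exact ⟨fun r => (hf' r).differentiableAt, contDiff_id.mul hκ⟩
  have hfe : ∀ r, f (-r) = f r := fun r => by
    simp only [f, neg_sq, GrimReaper.radialAverage_even 1 hκe]
  let u : GrimReaper.P n → ℝ := fun x => f (GrimReaper.radius x)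
  have hu : ContDiff ℝ ∞ u := (GrimReaper.contDiff_comp_norm hf hfe).comp contDiff_snd
  have hdu : ∀ q w : GrimReaper.P n, fderiv ℝ u q w = κ ‖q.2‖ * inner ℝ q.2 w.2 := fun q w => by
    have h : HasFDerivAt u _ q :=
      (GrimReaper.hasFDerivAt_comp_norm hf' q.2).comp q hasFDerivAt_snd
    rw [h.fderiv]
    simp
  refine ⟨u, GrimReaper.isTranslatingSoliton_radial hn hform hg hreg hu hdu hκd
    (by rw [← hn1, hκ0]) fun r hr => by rw [← hlog r hr]; exact hODE r hr, ?_, f, hf,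
    fun x => rfl, fun x hx => ?_⟩
  · rintro _ ⟨x, rfl⟩ ⟨t, y⟩ ⟨ht, hy⟩
    refine ⟨y, Prod.ext ?_ rfl⟩
    rw [Set.mem_singleton_iff.1 ht]
    exact congrArg f hy
  · have h2 : HasDerivAt (fun r => r * κ r) (1 * κ (GrimReaper.radius x)
        + GrimReaper.radius x * deriv κ (GrimReaper.radius x)) (GrimReaper.radius x) :=
      (hasDerivAt_id _).mul hκd.differentiableAt.hasDerivAt
    have h := hODE _ hx
    rw [hlog _ hx] at h
    rw [hdf, h2.deriv, GrimReaper.equidistantMeanCurvature,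
      GrimReaper.laplaceBeltrami_radius hn hform hg hreg hx, ← h]
    field_simp
    ring
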